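/- **Theorem (Eilenberg–Zilber for closure spaces).** A *closure space* is a set $X$ with an operation $c:\mathcal P(X)\to\mathcal P(X)$ such that $c(\emptyset)=\emptyset$, $A\subseteq c(A)$ and $c(A\cup B)=c(A)\cup c(B)$. A map $f:(X,c)\to(Y,d)$ is continuous if $f(c(A))\subseteq d(f(A))$ for all $A\subseteq X$. A set $V\subseteq X$ is a neighborhood of $x$ if $x\notin c(X\setminus V)$. The product closure on $X\times Y$ is the one for which the sets $U\times V$, with $U$ a neighborhood of $x$ and $V$ a neighborhood of $y$, form a local base at $(x,y)$; the product of finitely many closure spaces is defined in the same way. Let $J\in\{I,J_+,J_1\}$, where $I=[0,1]$ with its usual topology, $J_+=\{0,1\}$ with $c(\{0\})=\{0,1\}$ and $c(\{1\})=\{1\}$, and $J_1=\{0,1\}$ with the indiscrete closure ($c(A)=\{0,1\}$ for all $A\neq\emptyset$). Let $|\Delta^n|^J$ be, respectively, the standard topological $n$-simplex, the set $\{0,\dots,n\}$ with $c(A)=\{j : i\le j \text{ for some } i\in A\}$, and the set $\{0,\dots,n\}$ with the indiscrete closure. * $C^J_\bullet(X)$ is the chain complex with $C^J_n(X)$ the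 free abelian group on the continuous maps $\sigma:|\Delta^n|^J\to X$ and $\partial\sigma=\sum_{i=0}^n(-1)^i\sigma\circ d^i$, where $d^i$ is the $i$-th face inclusion. * $C^{(J,\times)}_\bullet(X)$ is the chain complex with $C^{(J,\times)}_n(X)$ the free abelian group on the continuous maps $\sigma:J^n\to X$ (with $J^n$ carrying the product closure), modulo the subgroup generated by the degenerate cubes, that is, those $\sigma$ that do not depend on some coordinate. The differential is induced by $\partial\sigma=\sum_{i=1}^n(-1)^i(A_i\sigma-B_i\sigma)$, where $A_i\sigma$ and $B_i\sigma$ are the restrictions of $\sigma$ to the faces on which the $i$-th coordinate is $0$ and $1$. The tensor product of chain complexes is $(C\otimes D)_n=\bigoplus_{i+j=n}C_i\otimes D_j$ with $\partial(a\otimes b)=\partial a\otimes b+(-1)^i a\otimes\partial b$ for $a\in C_i$. Then for each $J\in\{I,J_+,J_1\}$ there are chain homotopy equivalences $$C^J_\bullet(X\times Y)\simeq C^J_\bullet(X)\otimes C^J_\bullet(Y),\qquad C^{(J,\times)}_\bullet(X\times Y)\simeq C^{(J,\times)}_\bullet(X)\otimes C^{(J,\times)}_\bullet(Y)$$ for closure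 spaces $X$ and $Y$, with $X\times Y$ carrying the product closure. They are natural in $X$ and $Y$ with respect to continuous maps: the chain maps in both directions, and the chain homotopies from the two composites to the identities, are natural. -/

import Mathlib

open CategoryTheory

universe u v w

namespace CechClosure

/-! ### Čech closure spaces -/

/-- A (Čech) closure operation on a type `X`. -/
class ClosureSpace (X : Type u) where
  /-- the closure operation -/
  cl : Set X → Set X
  cl_empty : cl ∅ = ∅
  subset_cl : ∀ A : Set X, A ⊆ cl A
  cl_union : ∀ A B : Set X, cl (A ∪ B) = cl A ∪ cl B

open ClosureSpace

theorem cl_mono {X : Type u} [ClosureSpace X] {A B : Set X} (h : A ⊆ B) : cl A ⊆ cl B := by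
  have h1 : cl B = cl A ∪ cl B := by rw [← cl_union, Set.union_eq_self_of_subset_left h]
  rw [h1]
  exact Set.subset_union_left

/-- The neighborhood filter of a point: `V` is a neighborhood of `x` when `x` belongs to the
interior `X - cl (X - V)` of `V`. -/
def nhd {X : Type u} [ClosureSpace X] (x : X) : Filter X where
  sets := {V | x ∈ (cl Vᶜ)ᶜ}
  univ_sets := by simp [cl_empty]
  sets_of_superset := by
    intro U V hU hUV hx
    exact hU (cl_mono (Set.compl_subset_compl.mpr hUV) hx)
  inter_sets := by
    intro U V hU hV
    simp only [Set.mem_ofPred_eq, Set.compl_inter, cl_union, Set.compl_union]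
    exact ⟨hU, hV⟩

theorem mem_nhd {X : Type u} [ClosureSpace X] {x : X} {V : Set X} :
    V ∈ nhd x ↔ x ∉ cl Vᶜ := Iff.rfl

theorem mem_cl_iff {X : Type u} [ClosureSpace X] {x : X} {A : Set X} :
    x ∈ cl A ↔ ∃ᶠ y in nhd x, y ∈ A := by
  have h : Aᶜ ∈ nhd x ↔ x ∉ cl A := by rw [mem_nhd, compl_compl]
  rw [Filter.Frequently, ← not_iff_not, not_not, ← h]
  rfl

theorem pure_le_nhd {X : Type u} [ClosureSpace X] (x : X) : pure x ≤ nhd x := by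
  intro V hV
  by_contra hx
  exact hV (subset_cl _ hx)

/-- The closure operation with prescribed neighborhood filters `N x`: a point `x` lies in the
closure of `A` iff every set in `N x` meets `A`. -/
@[reducible]
def ofNhd {X : Type u} (N : X → Filter X) (hN : ∀ x, pure x ≤ N x) : ClosureSpace X where
  cl A := {x | ∀ U ∈ N x, (U ∩ A).Nonempty}
  cl_empty := by
    ext x
    simp only [Set.inter_empty, Set.not_nonempty_empty, Set.mem_ofPred_eq, Set.mem_empty_iff_false,
      iff_false]
    exact fun h => h Set.univ Filter.univ_mem
  subset_cl := fun A x hx U hU => ⟨x, hN x hU, hx⟩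
  cl_union := by
    intro A B
    have key : ∀ (C : Set X) (x : X),
        (∀ U ∈ N x, (U ∩ C).Nonempty) ↔ ∃ᶠ y in N x, y ∈ C := by
      intro C x
      rw [Filter.frequently_iff]
      exact ⟨fun h U hU => h U hU, fun h U hU => h hU⟩
    ext x
    exact (key _ x).trans (Filter.frequently_or_distrib.trans
      (or_congr (key A x).symm (key B x).symm))

theorem nhd_ofNhd {X : Type u} (N : X → Filter X) (hN : ∀ x, pure x ≤ N x) (x : X) :
    @nhd X (ofNhd N hN) x = N x := by
  ext V
  rw [@mem_nhd X (ofNhd N hN)]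
  constructor
  · intro h
    change ¬ ∀ U ∈ N x, (U ∩ Vᶜ).Nonempty at h
    simp only [not_forall, Set.not_nonempty_iff_eq_empty] at h
    obtain ⟨U, hU, hUV⟩ := h
    refine Filter.mem_of_superset hU ?_
    rw [← Set.sdiff_eq, Set.sdiff_eq_empty] at hUV
    exact hUV
  · intro h hx
    obtain ⟨y, hy, hy'⟩ := hx V h
    exact hy' hy

/-- The product closure on `X × Y`: the sets `U × V`, with `U` and `V` neighborhoods of `x` and
`y`, form a local base at `(x, y)`. -/
instance prodClosure (X : Type u) (Y : Type v) [ClosureSpace X] [ClosureSpace Y] :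
    ClosureSpace (X × Y) :=
  ofNhd (fun p => nhd p.1 ×ˢ nhd p.2) (fun p => by
    refine le_trans (le_of_eq ?_) (Filter.prod_mono (pure_le_nhd p.1) (pure_le_nhd p.2))
    exact Filter.prod_pure_pure.symm)

theorem nhd_prod {X : Type u} {Y : Type v} [ClosureSpace X] [ClosureSpace Y] (p : X × Y) :
    nhd p = nhd p.1 ×ˢ nhd p.2 :=
  nhd_ofNhd (fun p : X × Y => nhd p.1 ×ˢ nhd p.2) (fun p =>
    le_trans (le_of_eq Filter.prod_pure_pure.symm)
      (Filter.prod_mono (pure_le_nhd p.1) (pure_le_nhd p.2))) p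

/-- The product closure on a product of a family: finite intersections of preimages of
neighborhoods of the coordinates form a local base. -/
instance piClosure {ι : Type u} (X : ι → Type v) [∀ i, ClosureSpace (X i)] :
    ClosureSpace (∀ i, X i) :=
  ofNhd (fun x => Filter.pi fun i => nhd (x i)) (fun x =>
    Filter.le_pi.mpr fun i => Filter.tendsto_pure_left.mpr fun _ hs => pure_le_nhd (x i) hs)

theorem nhd_pi {ι : Type u} {X : ι → Type v} [∀ i, ClosureSpace (X i)] (x : ∀ i, X i) :
    nhd x = Filter.pi fun i => nhd (x i) :=
  nhd_ofNhd (fun x : ∀ i, X i => Filter.pi fun i => nhd (x i)) (fun x =>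
    Filter.le_pi.mpr fun i => Filter.tendsto_pure_left.mpr fun _ hs => pure_le_nhd (x i) hs) x

/-- The closure operation of a topological space. -/
@[reducible]
def topClosure (X : Type u) [TopologicalSpace X] : ClosureSpace X where
  cl := closure
  cl_empty := closure_empty
  subset_cl := fun _ => subset_closure
  cl_union := fun _ _ => closure_union

/-- The closure `cl {i} = {j | i ≤ j}` on a preorder, that is, the topological closure whose
open sets are the down-sets. -/
@[reducible]
def upClosure (X : Type u) [Preorder X] : ClosureSpace X where
  cl A := {j | ∃ i ∈ A, i ≤ j}
  cl_empty := by ext; simp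
  subset_cl := fun _ i hi => ⟨i, hi, le_refl i⟩
  cl_union := by
    intro A B
    ext j
    simp only [Set.mem_union, Set.mem_ofPred_eq, or_and_right, exists_or]

/-- The indiscrete closure: `cl A` is everything unless `A` is empty. -/
@[reducible]
def indiscreteClosure (X : Type u) : ClosureSpace X where
  cl A := {_x | A.Nonempty}
  cl_empty := by ext; simp
  subset_cl := fun _ x hx => ⟨x, hx⟩
  cl_union := by
    intro A B
    ext j
    simp only [Set.mem_union, Set.mem_ofPred_eq, Set.union_nonempty]

/-! ### Continuous maps and the category of closure spaces -/

/-- Continuity of a map of closure spaces. -/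
def Cont {X : Type u} {Y : Type v} [ClosureSpace X] [ClosureSpace Y] (f : X → Y) : Prop :=
  ∀ A : Set X, f '' cl A ⊆ cl (f '' A)

theorem cont_iff {X : Type u} {Y : Type v} [ClosureSpace X] [ClosureSpace Y] {f : X → Y} :
    Cont f ↔ ∀ x, Filter.Tendsto f (nhd x) (nhd (f x)) := by
  constructor
  · intro hf x V hV
    by_contra hx
    have hx' : x ∈ cl (f ⁻¹' V)ᶜ := by
      by_contra h
      exact hx h
    refine hV (cl_mono ?_ (hf _ ⟨x, hx', rfl⟩))
    rintro _ ⟨y, hy, rfl⟩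
    exact hy
  · rintro hf A _ ⟨x, hx, rfl⟩
    rw [mem_cl_iff] at hx ⊢
    exact (hf x).frequently (hx.mono fun y hy => ⟨y, hy, rfl⟩)

/-- Continuous maps of closure spaces. -/
@[ext]
structure CMap (X : Type u) (Y : Type v) [ClosureSpace X] [ClosureSpace Y] where
  toFun : X → Y
  cont : Cont toFun

namespace CMap

instance {X : Type u} {Y : Type v} [ClosureSpace X] [ClosureSpace Y] : FunLike (CMap X Y) X Y where
  coe := toFun
  coe_injective := fun f g h => by cases f; cases g; congr

/-- The identity map. -/
def id (X : Type u) [ClosureSpace X] : CMap X X :=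
  ⟨fun x => x, cont_iff.mpr fun _ => Filter.tendsto_id⟩

/-- Composition of continuous maps. -/
def comp {X : Type u} {Y : Type v} {Z : Type w} [ClosureSpace X] [ClosureSpace Y]
    [ClosureSpace Z] (g : CMap Y Z) (f : CMap X Y) : CMap X Z :=
  ⟨fun x => g.toFun (f.toFun x),
    cont_iff.mpr fun x => (cont_iff.mp g.cont (f.toFun x)).comp (cont_iff.mp f.cont x)⟩

/-- The product of two continuous maps. -/
def prodMap {X : Type u} {X' : Type u} {Y : Type v} {Y' : Type v} [ClosureSpace X]
    [ClosureSpace X'] [ClosureSpace Y] [ClosureSpace Y'] (f : CMap X X') (g : CMap Y Y') :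
    CMap (X × Y) (X' × Y') :=
  ⟨fun p => (f.toFun p.1, g.toFun p.2), cont_iff.mpr fun p => by
    have h := (cont_iff.mp f.cont p.1).prodMap (cont_iff.mp g.cont p.2)
    rw [nhd_prod, nhd_prod]
    exact h⟩

end CMap

/-- Bundled closure spaces. -/
structure Cl where
  carrier : Type u
  [str : ClosureSpace carrier]

namespace Cl

instance : CoeSort Cl.{u} (Type u) := ⟨carrier⟩

instance (X : Cl.{u}) : ClosureSpace X := X.str

/-- The category of closure spaces and continuous maps. -/
instance : Category.{u} Cl.{u} where
  Hom X Y := CMap X Y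
  id X := CMap.id X
  comp f g := CMap.comp g f

/-- The product `X × Y` with the product closure, as a functor of the pair `(X, Y)`. -/
def prodFunctor : Cl.{u} × Cl.{u} ⥤ Cl.{u} where
  obj P := ⟨P.1 × P.2⟩
  map f := CMap.prodMap f.1 f.2

/-- Topological spaces as closure spaces. -/
def ofTop : TopCat.{u} ⥤ Cl.{u} where
  obj X := @Cl.mk X (topClosure X)
  map {X Y} f := @CMap.mk X Y (topClosure X) (topClosure Y) f
    (fun _ => image_closure_subset_closure_image f.hom.continuous)

end Cl

/-! ### The intervals `I`, `J₊`, `J₁` and their simplices -/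

/-- Labels of the three intervals `I`, `J₊`, `J₁`. -/
inductive Interval
  | I
  | JPlus
  | JOne

namespace Interval

/-- `I` is the unit interval, `J₊` is `{0, 1}` with `cl {0} = {0, 1}` and `cl {1} = {1}`, and
`J₁` is `{0, 1}` with the indiscrete closure. -/
def space : Interval → Cl.{0}
  | I => @Cl.mk unitInterval (topClosure _)
  | JPlus => @Cl.mk (Fin 2) (upClosure _)
  | JOne => @Cl.mk (Fin 2) (indiscreteClosure _)

/-- The endpoint `0`. -/
def zero : (J : Interval) → J.space
  | I => (0 : unitInterval)
  | JPlus => (0 : Fin 2)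
  | JOne => (0 : Fin 2)

/-- The endpoint `1`. -/
def one : (J : Interval) → J.space
  | I => (1 : unitInterval)
  | JPlus => (1 : Fin 2)
  | JOne => (1 : Fin 2)

/-- The `J`-simplices `|Δⁿ|^J` as a cosimplicial closure space. For `J = I` this is the standard
topological simplex; for `J = J₊` it is `{0, …, n}` with `cl {i} = {j | i ≤ j}`; for `J = J₁` it
is `{0, …, n}` with the indiscrete closure. Order preserving maps act on vertices. -/
noncomputable def simplex : Interval → (SimplexCategory ⥤ Cl.{0})
  | I => SimplexCategory.toTop₀ ⋙ Cl.ofTop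
  | JPlus =>
    { obj := fun n => @Cl.mk (Fin (n.len + 1)) (upClosure _)
      map := fun {m n} f => @CMap.mk _ _ (upClosure _) (upClosure _) f.toOrderHom (by
        rintro A _ ⟨j, ⟨i, hi, hij⟩, rfl⟩
        exact ⟨_, ⟨i, hi, rfl⟩, f.toOrderHom.monotone hij⟩) }
  | JOne =>
    { obj := fun n => @Cl.mk (Fin (n.len + 1)) (indiscreteClosure _)
      map := fun {m n} f => @CMap.mk _ _ (indiscreteClosure _) (indiscreteClosure _) f.toOrderHom
        (by
          rintro A _ ⟨j, ⟨i, hi⟩, rfl⟩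
          exact ⟨_, ⟨i, hi, rfl⟩⟩) }

end Interval

/-! ### Singular simplicial chains -/

/-- The free module on a set. -/
noncomputable def freeMod (R : Type v) [CommRing R] : Type u ⥤ ModuleCat.{max u v} R where
  obj S := ModuleCat.of R (S →₀ R)
  map f := ModuleCat.ofHom (Finsupp.lmapDomain R R f)
  map_id _ := ModuleCat.hom_ext (Finsupp.lmapDomain_id R R)
  map_comp f g := ModuleCat.hom_ext (Finsupp.lmapDomain_comp R R f g)

/-- The `J`-nerve of a closure space: its `n`-simplices are the continuous maps `|Δⁿ|^J → X`. -/
noncomputable def nerve (J : Interval) : Cl.{u} ⥤ SSet.{u} where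
  obj X :=
    { obj := fun n => CMap (J.simplex.obj n.unop) X
      map := fun θ => TypeCat.ofHom fun σ => σ.comp (J.simplex.map θ.unop)
      map_id := fun n => by
        ext σ
        simp only [unop_id, CategoryTheory.Functor.map_id]
        rfl
      map_comp := fun f g => by
        ext σ
        simp only [unop_comp, CategoryTheory.Functor.map_comp]
        rfl }
  map f := { app := fun n => TypeCat.ofHom fun σ => f.comp σ }

/-- The singular simplicial chain complex `C^J(X)`: the free abelian group on the continuous maps
`|Δⁿ|^J → X` in degree `n`, with the alternating sum of the faces as differential. -/
noncomputable def simplicialChains (J : Interval) :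
    Cl.{u} ⥤ ChainComplex (ModuleCat.{u} ℤ) ℕ :=
  nerve J ⋙ (SimplicialObject.whiskering _ _).obj (freeMod ℤ) ⋙
    AlgebraicTopology.alternatingFaceMapComplex _

/-! ### Singular cubical chains -/

namespace Interval

/-- The `n`-cube `J^n` with the product closure. -/
abbrev Cube (J : Interval) (n : ℕ) : Type := Fin n → J.space

/-- The face inclusion `J^n → J^(n+1)` inserting the value `e` at the coordinate `i`. -/
def insert (J : Interval) {n : ℕ} (i : Fin (n + 1)) (e : J.space) :
    CMap (J.Cube n) (J.Cube (n + 1)) :=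
  ⟨fun x => i.insertNth e x, cont_iff.mpr fun x => by
    rw [nhd_pi, nhd_pi, Filter.tendsto_pi]
    intro k
    refine Fin.succAboveCases i ?_ (fun j => ?_) k
    · simp only [Fin.insertNth_apply_same]
      exact Filter.tendsto_const_pure.mono_right (pure_le_nhd e)
    · simp only [Fin.insertNth_apply_succAbove]
      exact Filter.tendsto_eval_pi _ j⟩

end Interval

/-- The set of singular `n`-cubes of `X`. -/
abbrev SingCube (J : Interval) (X : Cl.{u}) (n : ℕ) : Type u := CMap (J.Cube n) X

namespace SingCube

variable {J : Interval} {X Y : Cl.{u}} {n : ℕ}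

/-- The face of a cube on which the coordinate `i` is equal to `e`. -/
def face (i : Fin (n + 1)) (e : J.space) (σ : SingCube J X (n + 1)) : SingCube J X n :=
  σ.comp (J.insert i e)

/-- A cube is degenerate if it does not depend on some coordinate, that is, if it factors through
a coordinate projection `J^n → J^(n-1)`. -/
def Degenerate (σ : SingCube J X n) : Prop :=
  ∃ i : Fin n, ∀ (x : J.Cube n) (t : J.space), σ.toFun (Function.update x i t) = σ.toFun x

theorem face_face (i : Fin (n + 2)) (j : Fin (n + 1)) (e d : J.space)
    (σ : SingCube J X (n + 2)) :
    face j d (face i e σ) = face (j.predAbove i) e (face (i.succAbove j) d σ) := by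
  have key : ∀ x : J.Cube n, (i.insertNth e (j.insertNth d x : J.Cube (n + 1)) : J.Cube (n + 2)) =
      (i.succAbove j).insertNth d ((j.predAbove i).insertNth e x : J.Cube (n + 1)) := by
    intro x
    rw [Fin.insertNth_eq_iff]
    have h := fun k => Fin.succAbove_succAbove_succAbove_predAbove i j k
    have h' := Fin.succAbove_succAbove_predAbove i j
    constructor
    · have h1 := Fin.insertNth_apply_succAbove (α := fun _ => J.space) (i.succAbove j) d
        ((j.predAbove i).insertNth e x : J.Cube (n + 1)) (j.predAbove i)
      rw [h', Fin.insertNth_apply_same] at h1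
      exact h1.symm
    · ext k
      refine Fin.succAboveCases j ?_ (fun l => ?_) k
      · simp [Fin.removeNth]
      · simp only [Fin.removeNth, Fin.insertNth_apply_succAbove]
        rw [← h l, Fin.insertNth_apply_succAbove, Fin.insertNth_apply_succAbove]
  ext x
  exact congrArg σ.toFun (key x)

theorem face_same_of_indep {i : Fin (n + 1)} {σ : SingCube J X (n + 1)}
    (h : ∀ (x : J.Cube (n + 1)) (t : J.space), σ.toFun (Function.update x i t) = σ.toFun x)
    (e d : J.space) : face i e σ = face i d σ := by
  ext x
  have h1 := h (i.insertNth d x) e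
  rw [Fin.update_insertNth] at h1
  exact h1

theorem degenerate_face {i : Fin (n + 1)} {k : Fin (n + 1)} (hk : i ≠ k)
    {σ : SingCube J X (n + 1)}
    (h : ∀ (x : J.Cube (n + 1)) (t : J.space), σ.toFun (Function.update x i t) = σ.toFun x)
    (e : J.space) : Degenerate (face k e σ) := by
  obtain ⟨j, rfl⟩ := Fin.exists_succAbove_eq hk
  refine ⟨j, fun x t => ?_⟩
  have h1 := h (k.insertNth e x) t
  rw [← Fin.insertNth_update] at h1
  exact h1

end SingCube

/-- The free abelian group on the singular `n`-cubes of `X`. -/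
abbrev CubeChains (J : Interval) (X : Cl.{u}) (n : ℕ) : Type u := SingCube J X n →₀ ℤ

namespace CubeChains

open SingCube

variable (J : Interval) (X : Cl.{u})

/-- The unnormalized cubical boundary `∂σ = ∑_{i=1}^{n+1} (-1)^i (A_i σ - B_i σ)`, where `A_i` and
`B_i` are the faces at `0` and `1`. Here the coordinates are numbered from `0`. -/
noncomputable def boundary (n : ℕ) : CubeChains J X (n + 1) →ₗ[ℤ] CubeChains J X n :=
  ∑ i : Fin (n + 1), (-1 : ℤ) ^ (i.val + 1) •
    (Finsupp.lmapDomain ℤ ℤ (face i J.zero) - Finsupp.lmapDomain ℤ ℤ (face i J.one))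

/-- The subgroup generated by the degenerate cubes. -/
noncomputable def degenerate (n : ℕ) : Submodule ℤ (CubeChains J X n) :=
  Submodule.span ℤ {c | ∃ σ : SingCube J X n, Degenerate σ ∧ c = Finsupp.single σ 1}

theorem boundary_single (n : ℕ) (σ : SingCube J X (n + 1)) :
    boundary J X n (Finsupp.single σ 1) = ∑ i : Fin (n + 1), (-1 : ℤ) ^ (i.val + 1) •
      (Finsupp.single (face i J.zero σ) 1 - Finsupp.single (face i J.one σ) 1) := by
  simp [boundary, LinearMap.sum_apply]

theorem boundary_boundary (n : ℕ) : boundary J X n ∘ₗ boundary J X (n + 1) = 0 := by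
  refine Finsupp.lhom_ext' fun σ => LinearMap.ext_ring ?_
  let G : Fin (n + 2) → J.space → Fin (n + 1) → J.space → CubeChains J X n :=
    fun i e j d => Finsupp.single (face j d (face i e σ)) 1
  have hG : ∀ i e j d, G (i.succAbove j) d (j.predAbove i) e = G i e j d := by
    intro i e j d
    exact congrArg (fun τ => Finsupp.single τ (1 : ℤ)) (face_face i j e d σ).symm
  let H : Fin (n + 2) × Fin (n + 1) → CubeChains J X n := fun p =>
    (-1 : ℤ) ^ (p.1.val + p.2.val) •
      ((G p.1 J.zero p.2 J.zero - G p.1 J.zero p.2 J.one) -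
        (G p.1 J.one p.2 J.zero - G p.1 J.one p.2 J.one))
  have hsum : ∑ p, H p = 0 := by
    refine Finset.sum_involution (fun p _ => (p.1.succAbove p.2, p.2.predAbove p.1)) ?_ ?_ ?_ ?_
    · rintro ⟨i, j⟩ -
      simp only [H, hG, Fin.neg_one_pow_succAbove_add_predAbove, neg_smul, ← smul_neg,
        ← smul_add]
      rw [show ∀ a b c d : CubeChains J X n, (a - b - (c - d)) + -(a - c - (b - d)) = 0 from
        fun a b c d => by abel, smul_zero]
    · rintro ⟨i, j⟩ - - h
      exact Fin.succAbove_ne i j (congrArg Prod.fst h)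
    · intro _ _
      exact Finset.mem_univ _
    · rintro ⟨i, j⟩ -
      simp only [Fin.succAbove_succAbove_predAbove, Fin.predAbove_predAbove_succAbove]
  have hcalc : boundary J X n (boundary J X (n + 1) (Finsupp.single σ 1)) = ∑ p, H p := by
    rw [boundary_single, map_sum, Fintype.sum_prod_type]
    refine Finset.sum_congr rfl fun i _ => ?_
    rw [map_smul, map_sub, boundary_single, boundary_single, ← Finset.sum_sub_distrib,
      Finset.smul_sum]
    refine Finset.sum_congr rfl fun j _ => ?_
    rw [← smul_sub, smul_smul]
    have : (-1 : ℤ) ^ (i.val + 1) * (-1) ^ (j.val + 1) = (-1) ^ (i.val + j.val) := by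
      rw [← pow_add, show i.val + 1 + (j.val + 1) = i.val + j.val + 2 by ring, pow_add]
      simp
    rw [this]
  exact hcalc.trans hsum

theorem single_mem_degenerate {n : ℕ} {σ : SingCube J X n} (h : Degenerate σ) :
    Finsupp.single σ 1 ∈ degenerate J X n :=
  Submodule.subset_span ⟨σ, h, rfl⟩

theorem degenerate_le (n : ℕ) :
    degenerate J X (n + 1) ≤ (degenerate J X n).comap (boundary J X n) := by
  refine Submodule.span_le.mpr ?_
  rintro _ ⟨σ, ⟨i, hi⟩, rfl⟩
  change boundary J X n (Finsupp.single σ 1) ∈ degenerate J X n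
  rw [boundary_single]
  refine Submodule.sum_mem _ fun k _ => Submodule.smul_mem _ _ ?_
  by_cases hk : i = k
  · subst hk
    rw [face_same_of_indep hi J.zero J.one, sub_self]
    exact Submodule.zero_mem _
  · exact Submodule.sub_mem _ (single_mem_degenerate J X (degenerate_face hk hi _))
      (single_mem_degenerate J X (degenerate_face hk hi _))

variable {X} {Y : Cl.{u}}

/-- The map induced on cubical chains by a continuous map. -/
noncomputable def map (f : X ⟶ Y) (n : ℕ) : CubeChains J X n →ₗ[ℤ] CubeChains J Y n :=
  Finsupp.lmapDomain ℤ ℤ (fun σ : SingCube J X n => CMap.comp f σ)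

theorem map_single (f : X ⟶ Y) (n : ℕ) (σ : SingCube J X n) :
    map J f n (Finsupp.single σ 1) = Finsupp.single (CMap.comp f σ) 1 := by
  simp [map]

theorem degenerate_le_map (f : X ⟶ Y) (n : ℕ) :
    degenerate J X n ≤ (degenerate J Y n).comap (map J f n) := by
  refine Submodule.span_le.mpr ?_
  rintro _ ⟨σ, ⟨i, hi⟩, rfl⟩
  change map J f n (Finsupp.single σ 1) ∈ degenerate J Y n
  rw [map_single]
  exact single_mem_degenerate J Y ⟨i, fun x t => congrArg (CMap.toFun f) (hi x t)⟩

theorem map_boundary (f : X ⟶ Y) (n : ℕ) :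
    boundary J Y n ∘ₗ map J f (n + 1) = map J f n ∘ₗ boundary J X n := by
  refine Finsupp.lhom_ext' fun σ => LinearMap.ext_ring ?_
  change boundary J Y n (map J f (n + 1) (Finsupp.single σ 1)) =
    map J f n (boundary J X n (Finsupp.single σ 1))
  rw [map_single, boundary_single, boundary_single, map_sum]
  refine Finset.sum_congr rfl fun i _ => ?_
  rw [map_smul, map_sub, map_single, map_single]
  rfl

end CubeChains

/-- The normalized singular cubical chain complex `C^(J,×)(X)`: singular cubical chains modulo
degenerate ones. -/
noncomputable def cubicalComplex (J : Interval) (X : Cl.{u}) :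
    ChainComplex (ModuleCat.{u} ℤ) ℕ :=
  ChainComplex.of
    (fun n => ModuleCat.of ℤ (CubeChains J X n ⧸ CubeChains.degenerate J X n))
    (fun n => ModuleCat.ofHom (Submodule.mapQ _ _ (CubeChains.boundary J X n)
      (CubeChains.degenerate_le J X n)))
    (fun n => by
      refine ModuleCat.hom_ext (Submodule.linearMap_qext _ (LinearMap.ext fun c => ?_))
      have h := LinearMap.congr_fun (CubeChains.boundary_boundary J X n) c
      change Submodule.Quotient.mk (CubeChains.boundary J X n (CubeChains.boundary J X (n + 1) c))
        = (0 : CubeChains J X n ⧸ CubeChains.degenerate J X n)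
      rw [show CubeChains.boundary J X n (CubeChains.boundary J X (n + 1) c) = 0 from h]
      rfl)

/-- The normalized singular cubical chain complex as a functor. -/
noncomputable def cubicalChains (J : Interval) : Cl.{u} ⥤ ChainComplex (ModuleCat.{u} ℤ) ℕ where
  obj X := cubicalComplex J X
  map {X Y} f :=
    { f := fun n => ModuleCat.ofHom (Submodule.mapQ _ _ (CubeChains.map J f n)
        (CubeChains.degenerate_le_map J f n))
      comm' := by
        rintro _ n rfl
        simp only [cubicalComplex, ChainComplex.of_d]
        refine ModuleCat.hom_ext (Submodule.linearMap_qext _ (LinearMap.ext fun c => ?_))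
        exact congrArg Submodule.Quotient.mk
          (LinearMap.congr_fun (CubeChains.map_boundary J f n) c) }
  map_id X := by
    ext n : 1
    refine ModuleCat.hom_ext (Submodule.linearMap_qext _ (LinearMap.ext fun c => ?_))
    exact congrArg Submodule.Quotient.mk (Finsupp.mapDomain_id (v := c))
  map_comp f g := by
    ext n : 1
    refine ModuleCat.hom_ext (Submodule.linearMap_qext _ (LinearMap.ext fun c => ?_))
    exact congrArg Submodule.Quotient.mk (Finsupp.mapDomain_comp (v := c)
      (f := fun σ => CMap.comp f σ) (g := fun σ => CMap.comp g σ))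

/-! ### Tensor products of chain complexes -/

/-- The tensor product of modules as a bifunctor. -/
noncomputable def tensorMod (R : Type v) [CommRing R] :
    ModuleCat.{u} R ⥤ ModuleCat.{u} R ⥤ ModuleCat.{u} R where
  obj A :=
    { obj := fun B => ModuleCat.of R (TensorProduct R A B)
      map := fun g => ModuleCat.ofHom (TensorProduct.map LinearMap.id g.hom)
      map_id := fun _ => ModuleCat.hom_ext TensorProduct.map_id
      map_comp := fun _ _ => ModuleCat.hom_ext (TensorProduct.ext' fun _ _ => rfl) }
  map f :=
    { app := fun _ => ModuleCat.ofHom (TensorProduct.map f.hom LinearMap.id)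
      naturality := fun _ _ _ => ModuleCat.hom_ext (TensorProduct.ext' fun _ _ => rfl) }
  map_id _ := NatTrans.ext (funext fun _ => ModuleCat.hom_ext TensorProduct.map_id)
  map_comp _ _ := NatTrans.ext (funext fun _ => ModuleCat.hom_ext
    (TensorProduct.ext' fun _ _ => rfl))

instance (R : Type v) [CommRing R] : (tensorMod.{u} R).Additive where
  map_add := NatTrans.ext (funext fun _ => ModuleCat.hom_ext
    (TensorProduct.map_add_left _ _ _))

instance (R : Type v) [CommRing R] (A : ModuleCat.{u} R) : ((tensorMod R).obj A).Additive where
  map_add := ModuleCat.hom_ext (TensorProduct.map_add_right _ _ _)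

instance (K L : ChainComplex (ModuleCat.{u} ℤ) ℕ) :
    HomologicalComplex.HasMapBifunctor K L (tensorMod ℤ) (ComplexShape.down ℕ) := by
  intro n
  have : Finite (ComplexShape.π (ComplexShape.down ℕ) (ComplexShape.down ℕ)
      (ComplexShape.down ℕ) ⁻¹' {n}) := by
    refine ((Finset.HasAntidiagonal.antidiagonal n).finite_toSet.subset ?_).to_subtype
    rintro ⟨i, j⟩ h
    exact Finset.mem_coe.mpr (Finset.HasAntidiagonal.mem_antidiagonal.mpr h)
  infer_instance

/-- The tensor product of chain complexes of abelian groups: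
`(C ⊗ D)_n = ⨁_{i + j = n} C_i ⊗ D_j` with `∂ (a ⊗ b) = ∂a ⊗ b + (-1)^i a ⊗ ∂b`. -/
noncomputable def tensorComplex : ChainComplex (ModuleCat.{u} ℤ) ℕ ×
    ChainComplex (ModuleCat.{u} ℤ) ℕ ⥤ ChainComplex (ModuleCat.{u} ℤ) ℕ :=
  Functor.uncurry.obj ((tensorMod ℤ).map₂HomologicalComplex (ComplexShape.down ℕ)
    (ComplexShape.down ℕ) (ComplexShape.down ℕ))

/-! ### Natural chain homotopy equivalences -/

/-- A natural chain homotopy equivalence between two functors to chain complexes: natural chain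
maps in both directions and natural chain homotopies from the two composites to the identities. -/
structure NaturalHomotopyEquiv {C : Type u} [Category.{v} C]
    (F G : C ⥤ ChainComplex (ModuleCat.{w} ℤ) ℕ) where
  hom : F ⟶ G
  inv : G ⟶ F
  homInv : ∀ X : C, Homotopy (hom.app X ≫ inv.app X) (𝟙 (F.obj X))
  invHom : ∀ X : C, Homotopy (inv.app X ≫ hom.app X) (𝟙 (G.obj X))
  homInv_natural : ∀ {X Y : C} (f : X ⟶ Y) (i j : ℕ),
    (F.map f).f i ≫ (homInv Y).hom i j = (homInv X).hom i j ≫ (F.map f).f j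
  invHom_natural : ∀ {X Y : C} (f : X ⟶ Y) (i j : ℕ),
    (G.map f).f i ≫ (invHom Y).hom i j = (invHom X).hom i j ≫ (G.map f).f j

end CechClosure

/-! The proof is by acyclic models. By the Yoneda lemma, a natural transformation out of `X ↦
ℤ[Hom(M, X)]` is the choice of one element at `M`. So it lifts along any natural transformation
whose image at `M` contains that element (`relProj_freeOn`), and this lifting property passes to
retracts. Chain maps and homotopies are built degree by degree in the functor category. The lifting
problems at the models are solvable because the augmented target complexes are exact there
(`exists_natural_chainMap`, `exists_natural_homotopy`). Since everything is a complex of functors,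
naturality of the maps and of the homotopies comes for free.

This is applied on pairs of closure spaces, the models being the pairs `(M i, M j)` with `M n` the
`n`-simplex or the `n`-cube, lifted to the ambient universe. A map into `X × Y` is a pair of maps,
so the product side in degree `n` is a retract of the free functor on `(M n, M n)`. The tensor
product of free functors on `M i` and `M j` is free on `(M i, M j)`. On the models both sides are
contractible onto their augmentations: the tensor side by `Augmentation.Contractible.tensor`, the
product side because cones and contractions of two spaces combine componentwise.

What remains is to contract the models. Simplicial chains are free in each degree, and the cone with
apex vertex `0` contracts a simplex: a straight-line cone for `I`, a monotone extension for `J₊`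
because `0` is least, and any extension at all for `J₁` (`Coning.contractible`). For cubes, the
maximum contracts `J` to its endpoint `1`, and the resulting cylinder is a contracting homotopy
modulo degenerate cubes (`Contraction.contractible`). Normalized cubical chains are a quotient and
not visibly free. However, the alternating sum over all ways of setting coordinates to zero kills
the degenerate cubes and naturally splits the quotient map, so they are a retract of a free functor
(`normalizeCubes_degenerate`, `mkQ_normalizeCubes`). -/

namespace CechClosure

open ClosureSpace TensorProduct

/-! ### Acyclic models -/

section AcyclicModels

variable {C : Type u} [Category.{v} C]

/-- A functor to chain complexes as a chain complex of functors. -/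
@[simps]
def degreewise (F : C ⥤ ChainComplex (ModuleCat.{w} ℤ) ℕ) :
    ChainComplex (C ⥤ ModuleCat.{w} ℤ) ℕ where
  X n := F ⋙ HomologicalComplex.eval _ _ n
  d i j :=
    { app := fun X => (F.obj X).d i j
      naturality := fun _ _ f => ((F.map f).comm i j) }
  shape i j h := by
    ext X : 2
    exact (F.obj X).shape i j h
  d_comp_d' i j k _ _ := by
    ext X : 2
    exact (F.obj X).d_comp_d i j k

/-- Projectivity of a functor relative to a class of models: it has the lifting property against
natural transformations whose image on the models is large enough. -/
def RelProj (𝓜 : C → Prop) (P : C ⥤ ModuleCat.{w} ℤ) : Prop :=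
  ∀ ⦃A B : C ⥤ ModuleCat.{w} ℤ⦄ (f : A ⟶ B) (φ : P ⟶ B),
    (∀ M, 𝓜 M → ∀ p : P.obj M, ∃ a : A.obj M, f.app M a = φ.app M p) →
      ∃ ψ : P ⟶ A, ψ ≫ f = φ

/-- An augmentation of a chain complex of abelian groups, extended by zero to all degrees. -/
structure Augmentation (K : ChainComplex (ModuleCat.{w} ℤ) ℕ) where
  ε : ∀ n, K.X n →ₗ[ℤ] ℤ
  ε_succ : ∀ n, ε (n + 1) = 0
  ε_d : ∀ i j (x : K.X i), ε j (K.d i j x) = 0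

/-- The augmented complex is exact. -/
structure Augmentation.Exact {K : ChainComplex (ModuleCat.{w} ℤ) ℕ} (a : Augmentation K) :
    Prop where
  surj : ∃ x, a.ε 0 x = 1
  exact_zero : ∀ x : K.X 0, a.ε 0 x = 0 → ∃ y : K.X 1, K.d 1 0 y = x
  exact_succ : ∀ n (x : K.X (n + 1)), K.d (n + 1) n x = 0 →
    ∃ y : K.X (n + 2), K.d (n + 2) (n + 1) y = x

variable {𝓜 : C → Prop} {F G : C ⥤ ChainComplex (ModuleCat.{w} ℤ) ℕ}

/-- A family of augmentations as a natural transformation to a constant functor. -/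
def augmentationTrans (aF : ∀ X, Augmentation (F.obj X))
    (nF : ∀ {X Y : C} (f : X ⟶ Y) (x : (F.obj X).X 0),
      (aF Y).ε 0 ((F.map f).f 0 x) = (aF X).ε 0 x) :
    (degreewise F).X 0 ⟶ (Functor.const C).obj (ModuleCat.of ℤ (ULift.{w} ℤ)) where
  app X := ModuleCat.ofHom (ULift.moduleEquiv.symm.toLinearMap ∘ₗ (aF X).ε 0)
  naturality X Y f := by
    refine ModuleCat.hom_ext (LinearMap.ext fun x => ?_)
    exact congrArg ULift.up (nF f x)

/-- Comparison of a projective complex with an acyclic one, carried out in the functor category.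
Exactness of the target is needed only on the models, because relative projectivity asks for
preimages nowhere else. -/
theorem exists_natural_chainMap (hF : ∀ n, RelProj 𝓜 ((degreewise F).X n))
    (aF : ∀ X, Augmentation (F.obj X)) (aG : ∀ X, Augmentation (G.obj X))
    (nF : ∀ {X Y : C} (f : X ⟶ Y) (x : (F.obj X).X 0),
      (aF Y).ε 0 ((F.map f).f 0 x) = (aF X).ε 0 x)
    (nG : ∀ {X Y : C} (f : X ⟶ Y) (x : (G.obj X).X 0),
      (aG Y).ε 0 ((G.map f).f 0 x) = (aG X).ε 0 x)
    (eG : ∀ M, 𝓜 M → (aG M).Exact) :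
    ∃ φ : degreewise F ⟶ degreewise G, ∀ (X : C) (x : (F.obj X).X 0),
      (aG X).ε 0 ((φ.f 0).app X x) = (aF X).ε 0 x := by
  obtain ⟨φ₀, h₀⟩ := hF 0 (augmentationTrans aG nG) (augmentationTrans aF nF) (by
    intro M hM p
    obtain ⟨x, hx⟩ := (eG M hM).surj
    -- An element of augmentation `1`, rescaled, has any prescribed augmentation.
    refine ⟨(aF M).ε 0 p • x, congrArg ULift.up ?_⟩
    change (aG M).ε 0 ((aF M).ε 0 p • x) = (aF M).ε 0 p
    simp [hx])
  have h₀' : ∀ (X : C) (x : (F.obj X).X 0), (aG X).ε 0 (φ₀.app X x) = (aF X).ε 0 x := by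
    intro X x
    have h := congrArg (fun t => (t.app X).hom x) h₀
    exact congrArg ULift.down h
  obtain ⟨φ₁, h₁⟩ := hF 1 ((degreewise G).d 1 0) ((degreewise F).d 1 0 ≫ φ₀) (by
    intro M hM p
    exact (eG M hM).exact_zero _ ((h₀' M _).trans ((aF M).ε_d 1 0 p)))
  -- The dependent tuple of two consecutive components is the datum on which `ChainComplex.mkHom`
  -- recurses.
  have step : ∀ (n : ℕ) (p : Σ' (f : (degreewise F).X n ⟶ (degreewise G).X n)
      (f' : (degreewise F).X (n + 1) ⟶ (degreewise G).X (n + 1)),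
        f' ≫ (degreewise G).d (n + 1) n = (degreewise F).d (n + 1) n ≫ f),
      ∃ f'' : (degreewise F).X (n + 2) ⟶ (degreewise G).X (n + 2),
        f'' ≫ (degreewise G).d (n + 2) (n + 1) = (degreewise F).d (n + 2) (n + 1) ≫ p.2.1 := by
    rintro n ⟨f, f', hf⟩
    refine hF (n + 2) ((degreewise G).d (n + 2) (n + 1)) _ ?_
    intro M hM p
    refine (eG M hM).exact_succ n _ ?_
    have h : (degreewise F).d (n + 2) (n + 1) ≫ f' ≫ (degreewise G).d (n + 1) n = 0 := by
      rw [hf, HomologicalComplex.d_comp_d_assoc, Limits.zero_comp]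
    exact congrArg (fun t => (t.app M).hom p) h
  choose s hs using step
  exact ⟨ChainComplex.mkHom _ _ φ₀ φ₁ h₁ (fun n p => ⟨s n p, hs n p⟩), h₀'⟩

/-- The same induction one degree higher: in each degree `e` minus the part of the homotopy already
built lands in cycles, which bound on the models. In degree `0` vanishing augmentation plays the
role of the cycle condition. -/
theorem exists_natural_homotopy (hF : ∀ n, RelProj 𝓜 ((degreewise F).X n))
    (aG : ∀ X, Augmentation (G.obj X)) (eG : ∀ M, 𝓜 M → (aG M).Exact)
    (e : degreewise F ⟶ degreewise G)
    (he : ∀ (X : C) (x : (F.obj X).X 0), (aG X).ε 0 ((e.f 0).app X x) = 0) :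
    Nonempty (Homotopy e 0) := by
  obtain ⟨h₀, e₀⟩ := hF 0 ((degreewise G).d 1 0) (e.f 0) (by
    intro M hM p
    exact (eG M hM).exact_zero _ (he M p))
  obtain ⟨h₁, e₁⟩ := hF 1 ((degreewise G).d 2 1) (e.f 1 - (degreewise F).d 1 0 ≫ h₀) (by
    intro M hM p
    refine (eG M hM).exact_succ 0 _ ?_
    have h : (e.f 1 - (degreewise F).d 1 0 ≫ h₀) ≫ (degreewise G).d 1 0 = 0 := by
      rw [Preadditive.sub_comp, Category.assoc, e₀, e.comm, sub_self]
    exact congrArg (fun t => (t.app M).hom p) h)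
  have step : ∀ (n : ℕ) (p : Σ' (f : (degreewise F).X n ⟶ (degreewise G).X (n + 1))
      (f' : (degreewise F).X (n + 1) ⟶ (degreewise G).X (n + 2)),
        e.f (n + 1) = (degreewise F).d (n + 1) n ≫ f + f' ≫ (degreewise G).d (n + 2) (n + 1)),
      ∃ f'' : (degreewise F).X (n + 2) ⟶ (degreewise G).X (n + 3),
        e.f (n + 2) = (degreewise F).d (n + 2) (n + 1) ≫ p.2.1 +
          f'' ≫ (degreewise G).d (n + 3) (n + 2) := by
    rintro n ⟨f, f', hf⟩
    obtain ⟨f'', h''⟩ := hF (n + 2) ((degreewise G).d (n + 3) (n + 2))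
      (e.f (n + 2) - (degreewise F).d (n + 2) (n + 1) ≫ f') (by
        intro M hM p
        refine (eG M hM).exact_succ (n + 1) _ ?_
        have h : (e.f (n + 2) - (degreewise F).d (n + 2) (n + 1) ≫ f') ≫
            (degreewise G).d (n + 2) (n + 1) = 0 := by
          rw [Preadditive.sub_comp, Category.assoc, e.comm, hf, Preadditive.comp_add,
            HomologicalComplex.d_comp_d_assoc, Limits.zero_comp, zero_add, sub_self]
        exact congrArg (fun t => (t.app M).hom p) h)
    exact ⟨f'', by rw [h'']; abel⟩
  choose s hs using step
  exact ⟨Homotopy.mkInductive e h₀ e₀.symm h₁ (by rw [e₁]; abel) (fun n p => ⟨s n p, hs n p⟩)⟩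

/-- A chain map of chain complexes of functors as a natural transformation. -/
@[simps]
def natTransOfDegreewise (φ : degreewise F ⟶ degreewise G) : F ⟶ G where
  app X :=
    { f := fun n => (φ.f n).app X
      comm' := fun i j _ => congrArg (fun t => t.app X) (φ.comm i j) }
  naturality X Y f := by
    ext n : 1
    exact (φ.f n).naturality f

/-- The value at an object of a homotopy of chain complexes of functors. -/
def homotopyApp {φ ψ : degreewise F ⟶ degreewise G} (h : Homotopy φ ψ) (X : C) :
    Homotopy ((natTransOfDegreewise φ).app X) ((natTransOfDegreewise ψ).app X) where
  hom i j := (h.hom i j).app X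
  zero i j hij := congrArg (fun t => t.app X) (h.zero i j hij)
  comm n := congrArg (fun t => t.app X) (h.comm n)

/-- Acyclic models: two functors whose components are projective relative to models on which both
are acyclic are naturally chain homotopy equivalent. -/
theorem nonempty_naturalHomotopyEquiv
    (hF : ∀ n, RelProj 𝓜 ((degreewise F).X n)) (hG : ∀ n, RelProj 𝓜 ((degreewise G).X n))
    (aF : ∀ X, Augmentation (F.obj X)) (aG : ∀ X, Augmentation (G.obj X))
    (nF : ∀ {X Y : C} (f : X ⟶ Y) (x : (F.obj X).X 0),
      (aF Y).ε 0 ((F.map f).f 0 x) = (aF X).ε 0 x)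
    (nG : ∀ {X Y : C} (f : X ⟶ Y) (x : (G.obj X).X 0),
      (aG Y).ε 0 ((G.map f).f 0 x) = (aG X).ε 0 x)
    (eF : ∀ M, 𝓜 M → (aF M).Exact) (eG : ∀ M, 𝓜 M → (aG M).Exact) :
    Nonempty (NaturalHomotopyEquiv F G) := by
  obtain ⟨φ, hφ⟩ := exists_natural_chainMap hF aF aG nF nG eG
  obtain ⟨ψ, hψ⟩ := exists_natural_chainMap hG aG aF nG nF eF
  -- Both the composite and the identity preserve augmentations, so their difference has
  -- augmentation zero.
  obtain ⟨h₁⟩ := exists_natural_homotopy hF aF eF (φ ≫ ψ - 𝟙 _) (by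
    intro X x
    refine (map_sub ((aF X).ε 0) ((ψ.f 0).app X ((φ.f 0).app X x)) x).trans ?_
    exact sub_eq_zero.mpr ((hψ X _).trans (hφ X x)))
  obtain ⟨h₂⟩ := exists_natural_homotopy hG aG eG (ψ ≫ φ - 𝟙 _) (by
    intro X x
    refine (map_sub ((aG X).ε 0) ((φ.f 0).app X ((ψ.f 0).app X x)) x).trans ?_
    exact sub_eq_zero.mpr ((hφ X _).trans (hψ X x)))
  have k₁ := Homotopy.equivSubZero.symm h₁
  have k₂ := Homotopy.equivSubZero.symm h₂
  -- The components of a homotopy in the functor category are natural transformations; their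
  -- naturality squares are the last two fields.
  exact ⟨{
    hom := natTransOfDegreewise φ
    inv := natTransOfDegreewise ψ
    homInv := homotopyApp k₁
    invHom := homotopyApp k₂
    homInv_natural := fun f i j => (k₁.hom i j).naturality f
    invHom_natural := fun f i j => (k₂.hom i j).naturality f }⟩

end AcyclicModels

/-! ### Free functors and their retracts -/

section Free

variable {C : Type u} [Category.{v} C]

/-- The free functor on a model, `X ↦ ℤ[Hom(M, X)]`. -/
noncomputable abbrev freeOn (M : C) : C ⥤ ModuleCat.{v} ℤ :=
  coyoneda.obj (Opposite.op M) ⋙ freeMod ℤ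

theorem lift_single_one {R S N : Type*} [CommRing R] [AddCommGroup N] [Module R N] (f : S → N)
    (s : S) : Finsupp.lift N R S f (Finsupp.single s 1) = f s := by
  simp

/-- Yoneda: a preimage `a` of the value at the identity of `M` is transported along every `g : M ⟶
X`, and naturality forces the result to be a lift. -/
theorem relProj_freeOn {𝓜 : C → Prop} {M : C} (hM : 𝓜 M) : RelProj 𝓜 (freeOn M) := by
  intro A B f φ h
  obtain ⟨a, ha⟩ := h M hM (Finsupp.single (𝟙 M) (1 : ℤ))
  let ψ (X : C) : ((M ⟶ X) →₀ ℤ) →ₗ[ℤ] A.obj X :=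
    Finsupp.lift (A.obj X) ℤ (M ⟶ X) (fun g => A.map g a)
  have hψ (X : C) (k : M ⟶ X) : ψ X (Finsupp.single k 1) = A.map k a := lift_single_one _ k
  have hfree {X Y : C} (k : M ⟶ X) (g : X ⟶ Y) :
      (freeOn M).map g (Finsupp.single k (1 : ℤ)) = Finsupp.single (k ≫ g) (1 : ℤ) :=
    Finsupp.mapDomain_single
  refine ⟨{
    app := fun X => ModuleCat.ofHom (ψ X)
    naturality := ?_ }, ?_⟩
  · intro X Y g
    refine ModuleCat.hom_ext (Finsupp.lhom_ext' fun k => LinearMap.ext_ring ?_)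
    change ψ Y ((freeOn M).map g (Finsupp.single k (1 : ℤ))) = A.map g (ψ X (Finsupp.single k 1))
    rw [hψ, hfree]
    refine (hψ Y _).trans ?_
    rw [A.map_comp]
    rfl
  · ext X : 2
    refine ModuleCat.hom_ext (Finsupp.lhom_ext' fun (k : M ⟶ X) => LinearMap.ext_ring ?_)
    change f.app X (ψ X (Finsupp.single k 1)) = φ.app X (Finsupp.single k (1 : ℤ))
    have h1 := congrArg (fun t => t.hom (Finsupp.single (𝟙 M) (1 : ℤ))) (φ.naturality k)
    have h2 := congrArg (fun t => t.hom a) (f.naturality k)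
    change φ.app X ((freeOn M).map k (Finsupp.single (𝟙 M) (1 : ℤ))) =
      B.map k (φ.app M (Finsupp.single (𝟙 M) (1 : ℤ))) at h1
    change f.app X (A.map k a) = B.map k (f.app M a) at h2
    rw [hfree, Category.id_comp] at h1
    rw [hψ, h2, h1, ha]

theorem RelProj.of_retract {𝓜 : C → Prop} {P Q : C ⥤ ModuleCat.{w} ℤ} (hQ : RelProj 𝓜 Q)
    (r : Retract P Q) : RelProj 𝓜 P := by
  intro A B f φ h
  obtain ⟨ψ, hψ⟩ := hQ f (r.r ≫ φ) (fun M hM p => h M hM (r.r.app M p))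
  exact ⟨r.i ≫ ψ, by rw [Category.assoc, hψ, r.retract_assoc]⟩

/-- The external tensor product of two functors to abelian groups. -/
noncomputable abbrev boxTensor {D : Type*} [Category* D] (P : C ⥤ ModuleCat.{w} ℤ)
    (Q : D ⥤ ModuleCat.{w} ℤ) : C × D ⥤ ModuleCat.{w} ℤ :=
  P.prod Q ⋙ Functor.uncurry.obj (tensorMod ℤ)

/-- Retracts are compatible with external tensor products. -/
noncomputable def retractBoxTensor {P P' Q Q' : C ⥤ ModuleCat.{w} ℤ} (r : Retract P P')
    (s : Retract Q Q') : Retract (boxTensor P Q) (boxTensor P' Q') where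
  i := Functor.whiskerRight (NatTrans.prod r.i s.i) _
  r := Functor.whiskerRight (NatTrans.prod r.r s.r) _
  retract := by
    rw [← Functor.whiskerRight_comp]
    have h : NatTrans.prod r.i s.i ≫ NatTrans.prod r.r s.r = 𝟙 (P.prod Q) := by
      ext X : 2
      exact Prod.ext (congrArg (fun t => t.app X.1) r.retract)
        (congrArg (fun t => t.app X.2) s.retract)
    rw [h, Functor.whiskerRight_id']

/-- The external tensor product of free functors is free. -/
noncomputable def boxTensorFreeOn (M N : C) :
    boxTensor (freeOn M) (freeOn N) ≅ freeOn (C := C × C) (M, N) :=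
  NatIso.ofComponents
    (fun X => (finsuppTensorFinsupp' ℤ (M ⟶ X.1) (N ⟶ X.2)).toModuleIso)
    (by
      intro X Y f
      refine ModuleCat.hom_ext (TensorProduct.ext (Finsupp.lhom_ext' fun k =>
        LinearMap.ext_ring (Finsupp.lhom_ext' fun l => LinearMap.ext_ring ?_)))
      change finsuppTensorFinsupp' ℤ (M ⟶ Y.1) (N ⟶ Y.2)
          (Finsupp.mapDomain (fun g => g ≫ f.1) (Finsupp.single k (1 : ℤ)) ⊗ₜ[ℤ]
            Finsupp.mapDomain (fun g => g ≫ f.2) (Finsupp.single l (1 : ℤ))) =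
        Finsupp.mapDomain (fun g : (M ⟶ X.1) × (N ⟶ X.2) => (g.1 ≫ f.1, g.2 ≫ f.2))
          (finsuppTensorFinsupp' ℤ (M ⟶ X.1) (N ⟶ X.2)
            (Finsupp.single k (1 : ℤ) ⊗ₜ[ℤ] Finsupp.single l (1 : ℤ)))
      rw [Finsupp.mapDomain_single, Finsupp.mapDomain_single,
        finsuppTensorFinsupp'_single_tmul_single, finsuppTensorFinsupp'_single_tmul_single,
        Finsupp.mapDomain_single])

/-- The components of a tensor product of complexes of functors are projective relative to the
models on which their pieces are. -/
theorem relProj_tensor {D : Type*} [Category* D] {𝓜 : C × D → Prop}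
    (F : C ⥤ ChainComplex (ModuleCat.{w} ℤ) ℕ) (G : D ⥤ ChainComplex (ModuleCat.{w} ℤ) ℕ)
    (h : ∀ i j, RelProj 𝓜 (boxTensor ((degreewise F).X i) ((degreewise G).X j))) (n : ℕ) :
    RelProj 𝓜 ((degreewise (F.prod G ⋙ tensorComplex)).X n) := by
  intro A B f φ hφ
  -- The inclusion of a summand. `tensorComplex` is an uncurried functor, so its action on a pair of
  -- maps is a composite of two one-variable maps, and naturality is checked one variable at a time.
  let ι (i j : ℕ) (hij : ComplexShape.π (ComplexShape.down ℕ) (ComplexShape.down ℕ)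
      (ComplexShape.down ℕ) (i, j) = n) :
      boxTensor ((degreewise F).X i) ((degreewise G).X j) ⟶
        (degreewise (F.prod G ⋙ tensorComplex)).X n :=
    { app := fun X => HomologicalComplex.ιMapBifunctor (F.obj X.1) (G.obj X.2) (tensorMod ℤ)
        (ComplexShape.down ℕ) i j n hij
      naturality := fun X Y g => by
        have h1 := HomologicalComplex.ι_mapBifunctorMap (F.map g.1) (𝟙 (G.obj X.2)) (tensorMod ℤ)
          (ComplexShape.down ℕ) i j n hij
        have h2 := HomologicalComplex.ι_mapBifunctorMap (𝟙 (F.obj Y.1)) (G.map g.2) (tensorMod ℤ)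
          (ComplexShape.down ℕ) i j n hij
        change _ = HomologicalComplex.ιMapBifunctor (F.obj X.1) (G.obj X.2) (tensorMod ℤ)
          (ComplexShape.down ℕ) i j n hij ≫ (HomologicalComplex.mapBifunctorMap (F.map g.1)
            (𝟙 (G.obj X.2)) (tensorMod ℤ) (ComplexShape.down ℕ)).f n ≫
          (HomologicalComplex.mapBifunctorMap (𝟙 (F.obj Y.1)) (G.map g.2) (tensorMod ℤ)
            (ComplexShape.down ℕ)).f n
        rw [reassoc_of% h1, h2]
        simp
        rfl }
  -- Lift separately on each summand; the lifts are then assembled by the universal property of the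
  -- coproduct.
  have key : ∀ i j hij, ∃ ψ : boxTensor ((degreewise F).X i) ((degreewise G).X j) ⟶ A,
      ψ ≫ f = ι i j hij ≫ φ := fun i j hij =>
    h i j f _ (fun M hM p => hφ M hM ((ι i j hij).app M p))
  choose ψ hψ using key
  let δ (X : C × D) : ((degreewise (F.prod G ⋙ tensorComplex)).X n).obj X ⟶ A.obj X :=
    HomologicalComplex.mapBifunctorDesc (fun i j hij => (ψ i j hij).app X)
  have hδ (i j : ℕ) (hij) (X : C × D) : (ι i j hij).app X ≫ δ X = (ψ i j hij).app X :=
    HomologicalComplex.ι_mapBifunctorDesc _ i j hij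
  refine ⟨{
    app := δ
    naturality := ?_ }, ?_⟩
  · intro X Y g
    refine HomologicalComplex.mapBifunctor.hom_ext fun i j hij => ?_
    change (ι i j hij).app X ≫ _ ≫ δ Y = (ι i j hij).app X ≫ δ X ≫ _
    rw [reassoc_of% hδ, ← NatTrans.naturality_assoc, hδ, NatTrans.naturality]
  · ext X : 2
    refine HomologicalComplex.mapBifunctor.hom_ext fun i j hij => ?_
    change (ι i j hij).app X ≫ δ X ≫ f.app X = (ι i j hij).app X ≫ φ.app X
    rw [reassoc_of% hδ]
    exact congrArg (fun t => t.app X) (hψ i j hij)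

end Free

/-! ### Contractible augmented complexes -/

namespace Augmentation

variable {K : ChainComplex (ModuleCat.{w} ℤ) ℕ} (a : Augmentation K)

/-- The chain endomorphism `x ↦ ε(x) v` through the augmentation. -/
noncomputable def pointMap (v : ∀ n, K.X n) : K ⟶ K where
  f n := ModuleCat.ofHom (LinearMap.toSpanSingleton ℤ (K.X n) (v n) ∘ₗ a.ε n)
  comm' i j hij := by
    obtain rfl : j + 1 = i := hij
    refine ModuleCat.hom_ext (LinearMap.ext fun x => ?_)
    change K.d (j + 1) j (LinearMap.toSpanSingleton ℤ (K.X (j + 1)) (v (j + 1))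
      (a.ε (j + 1) x)) = LinearMap.toSpanSingleton ℤ (K.X j) (v j) (a.ε j (K.d (j + 1) j x))
    rw [a.ε_succ, a.ε_d, LinearMap.zero_apply, map_zero, map_zero, map_zero]

/-- The identity is chain homotopic to a map through the augmentation. -/
def Contractible : Prop :=
  ∃ v : ∀ n, K.X n, a.ε 0 (v 0) = 1 ∧ Nonempty (Homotopy (𝟙 K) (a.pointMap v))

-- On an element that is a cycle, or has augmentation zero in degree `0`, the homotopy formula
-- reduces to `x = d (h x)`.
variable {a} in
theorem Contractible.exact (h : a.Contractible) : a.Exact := by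
  obtain ⟨v, hv, ⟨h⟩⟩ := h
  refine ⟨⟨v 0, hv⟩, fun x hx => ⟨h.hom 0 1 x, ?_⟩, fun n x hx => ⟨h.hom (n + 1) (n + 2) x, ?_⟩⟩
  · have hc := congrArg (fun t => t.hom x) (h.comm 0)
    rw [Homotopy.dNext_zero_chainComplex, Homotopy.prevD_chainComplex] at hc
    change x = 0 + K.d 1 0 (h.hom 0 1 x) + LinearMap.toSpanSingleton ℤ (K.X 0) (v 0) (a.ε 0 x) at hc
    rw [hx, map_zero, add_zero, zero_add] at hc
    exact hc.symm
  · have hc := congrArg (fun t => t.hom x) (h.comm (n + 1))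
    rw [Homotopy.dNext_succ_chainComplex, Homotopy.prevD_chainComplex] at hc
    change x = h.hom n (n + 1) (K.d (n + 1) n x) + K.d (n + 2) (n + 1) (h.hom (n + 1) (n + 2) x) +
      LinearMap.toSpanSingleton ℤ (K.X (n + 1)) (v (n + 1)) (a.ε (n + 1) x) at hc
    rw [hx, a.ε_succ, LinearMap.zero_apply, map_zero, map_zero, add_zero, zero_add] at hc
    exact hc.symm

/-- Contractibility from a degree raising map with the cone identities. -/
theorem contractible_of_maps (v : ∀ n, K.X n) (hv : a.ε 0 (v 0) = 1)
    (h : ∀ n, K.X n →ₗ[ℤ] K.X (n + 1))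
    (h₀ : ∀ x : K.X 0, x = K.d 1 0 (h 0 x) + LinearMap.toSpanSingleton ℤ (K.X 0) (v 0) (a.ε 0 x))
    (h₁ : ∀ n (x : K.X (n + 1)), x = h n (K.d (n + 1) n x) + K.d (n + 2) (n + 1) (h (n + 1) x)) :
    a.Contractible := by
  refine ⟨v, hv, ⟨{
    -- A homotopy has components for all pairs of degrees; those other than `i + 1 = j` are set to
    -- zero.
    hom := fun i j => if hij : i + 1 = j then
      ModuleCat.ofHom (h i) ≫ eqToHom (congrArg K.X hij) else 0
    zero := fun i j hij => dif_neg hij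
    comm := ?_ }⟩⟩
  intro n
  refine ModuleCat.hom_ext (LinearMap.ext fun x => ?_)
  rw [Homotopy.prevD_chainComplex, dif_pos rfl, eqToHom_refl, Category.comp_id]
  cases n with
  | zero =>
    rw [Homotopy.dNext_zero_chainComplex]
    change x = 0 + K.d 1 0 (h 0 x) + LinearMap.toSpanSingleton ℤ (K.X 0) (v 0) (a.ε 0 x)
    rw [zero_add]
    exact h₀ x
  | succ n =>
    rw [Homotopy.dNext_succ_chainComplex, dif_pos rfl, eqToHom_refl, Category.comp_id]
    change x = h n (K.d (n + 1) n x) + K.d (n + 2) (n + 1) (h (n + 1) x) +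
      LinearMap.toSpanSingleton ℤ (K.X (n + 1)) (v (n + 1)) (a.ε (n + 1) x)
    rw [a.ε_succ, LinearMap.zero_apply, map_zero, add_zero]
    exact h₁ n x

end Augmentation

/-! ### Tensor products of augmented complexes -/

section Tensor

open HomologicalComplex

variable (K L : ChainComplex (ModuleCat.{w} ℤ) ℕ)

/-- The elements `x ⊗ y` of the tensor product of two complexes. -/
noncomputable def tmul {i j n : ℕ} (h : i + j = n) (x : K.X i) (y : L.X j) :
    (tensorComplex.obj (K, L)).X n :=
  ιMapBifunctor K L (tensorMod ℤ) (ComplexShape.down ℕ) i j n h (x ⊗ₜ[ℤ] y)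

variable {K L} (a : Augmentation K) (b : Augmentation L)

/-- The product of two linear forms as a map to a lifted copy of the ring. -/
noncomputable def tmulForms {R : Type} [CommRing R] {A B : Type w} [AddCommGroup A] [Module R A]
    [AddCommGroup B] [Module R B] (f : A →ₗ[R] R) (g : B →ₗ[R] R) :
    ModuleCat.of R (A ⊗[R] B) ⟶ ModuleCat.of R (ULift.{w} R) :=
  ModuleCat.ofHom
    (ULift.moduleEquiv.symm.toLinearMap ∘ₗ LinearMap.mul' R R ∘ₗ TensorProduct.map f g)

/-- Used to identify the tensor product of two maps through the augmentations with a map through the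
product augmentation. -/
theorem map_toSpanSingleton_tmul {R : Type*} [CommRing R] {A B N : Type*} [AddCommGroup A]
    [Module R A] [AddCommGroup B] [Module R B] [AddCommGroup N] [Module R N]
    (f : A ⊗[R] B →ₗ[R] N) (x : A) (y : B) (r s : R) :
    f (LinearMap.toSpanSingleton R A x r ⊗ₜ LinearMap.toSpanSingleton R B y s) =
      LinearMap.toSpanSingleton R N (f (x ⊗ₜ y)) (r * s) := by
  simp only [LinearMap.toSpanSingleton_apply]
  rw [TensorProduct.smul_tmul_smul, map_smul]

/-- The product of two augmentations as a map to a lifted copy of `ℤ`. -/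
noncomputable def tensorAugHom (n : ℕ) :
    (tensorComplex.obj (K, L)).X n ⟶ ModuleCat.of ℤ (ULift.{w} ℤ) :=
  mapBifunctorDesc (K₁ := K) (K₂ := L) (F := tensorMod ℤ) (c := ComplexShape.down ℕ)
    (fun i j _ => tmulForms (a.ε i) (b.ε j))

theorem ι_tensorAugHom (i j n : ℕ) (h : i + j = n) :
    ιMapBifunctor K L (tensorMod ℤ) (ComplexShape.down ℕ) i j n h ≫ tensorAugHom a b n =
      tmulForms (a.ε i) (b.ε j) :=
  ι_mapBifunctorDesc _ i j h

theorem tensorAugHom_tmul {i j n : ℕ} (h : i + j = n) (x : K.X i) (y : L.X j) :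
    tensorAugHom a b n (tmul K L h x y) = ULift.up (a.ε i x * b.ε j y) :=
  congrArg (fun t => t.hom (x ⊗ₜ[ℤ] y)) (ι_tensorAugHom a b i j n h)

theorem tensorComplex_hom_ext {n : ℕ} {A : ModuleCat.{w} ℤ}
    {f g : (tensorComplex.obj (K, L)).X n ⟶ A}
    (h : ∀ (i j : ℕ) (hij : i + j = n) (x : K.X i) (y : L.X j),
      f (tmul K L hij x y) = g (tmul K L hij x y)) : f = g :=
  mapBifunctor.hom_ext fun i j hij => ModuleCat.hom_ext (TensorProduct.ext' (h i j hij))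

/-- On each summand, each of the two halves of the differential contributes a factor `ε (d x)` or `ε
(d y)`, or is already zero. -/
theorem d_tensorAugHom (n m : ℕ) : (tensorComplex.obj (K, L)).d n m ≫ tensorAugHom a b m = 0 := by
  have hT (i j : ℕ) (h : i + j = m) := ι_tensorAugHom a b i j m h
  -- Only the values of the map on the summands matter from here on; with it generalized, the tensor
  -- complex can be replaced by its underlying `mapBifunctor`.
  revert hT
  generalize tensorAugHom a b m = T
  change (mapBifunctor K L (tensorMod ℤ) (ComplexShape.down ℕ)).X m ⟶ _ at T
  intro hT
  change (mapBifunctor K L (tensorMod ℤ) (ComplexShape.down ℕ)).d n m ≫ T = 0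
  rw [mapBifunctor.d_eq, Preadditive.add_comp]
  have h₁ : mapBifunctor.D₁ K L (tensorMod ℤ) (ComplexShape.down ℕ) n m ≫ T = 0 := by
    refine mapBifunctor.hom_ext fun i j hij => ?_
    rw [mapBifunctor.ι_D₁_assoc, Limits.comp_zero]
    cases i with
    | zero => rw [mapBifunctor.d₁_eq_zero _ _ _ _ _ _ _ (by simp), Limits.zero_comp]
    | succ i =>
      rw [mapBifunctor.d₁_eq' _ _ _ _ (show (ComplexShape.down ℕ).Rel (i + 1) i from rfl),
        Linear.units_smul_comp, Category.assoc]
      by_cases h : i + j = m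
      · rw [ιMapBifunctorOrZero_eq _ _ _ _ _ _ _ h, hT i j h]
        refine (congrArg _ ?_).trans (smul_zero _)
        refine ModuleCat.hom_ext (TensorProduct.ext' fun x y => ?_)
        change ULift.up (a.ε i (K.d (i + 1) i x) * b.ε j y) = 0
        rw [a.ε_d, zero_mul]
        rfl
      · rw [ιMapBifunctorOrZero_eq_zero _ _ _ _ _ _ _ h, Limits.zero_comp, Limits.comp_zero,
          smul_zero]
  have h₂ : mapBifunctor.D₂ K L (tensorMod ℤ) (ComplexShape.down ℕ) n m ≫ T = 0 := by
    refine mapBifunctor.hom_ext fun i j hij => ?_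
    rw [mapBifunctor.ι_D₂_assoc, Limits.comp_zero]
    cases j with
    | zero => rw [mapBifunctor.d₂_eq_zero _ _ _ _ _ _ _ (by simp), Limits.zero_comp]
    | succ j =>
      rw [mapBifunctor.d₂_eq' _ _ _ _ _ (show (ComplexShape.down ℕ).Rel (j + 1) j from rfl),
        Linear.units_smul_comp, Category.assoc]
      by_cases h : i + j = m
      · rw [ιMapBifunctorOrZero_eq _ _ _ _ _ _ _ h, hT i j h]
        -- The Koszul sign is irrelevant, since what it multiplies is already zero.
        refine (congrArg _ ?_).trans (smul_zero _)
        refine ModuleCat.hom_ext (TensorProduct.ext' fun x y => ?_)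
        change ULift.up (a.ε i x * b.ε j (L.d (j + 1) j y)) = 0
        rw [b.ε_d, mul_zero]
        rfl
      · rw [ιMapBifunctorOrZero_eq_zero _ _ _ _ _ _ _ h, Limits.zero_comp, Limits.comp_zero,
          smul_zero]
  rw [h₁, h₂, add_zero]

/-- In positive total degree one of the two factors has positive degree, where its augmentation
vanishes. -/
theorem Augmentation.mul_eq_zero {i j n : ℕ} (h : i + j = n + 1) (x : K.X i) (y : L.X j) :
    a.ε i x * b.ε j y = 0 := by
  cases i with
  | succ i => rw [a.ε_succ, LinearMap.zero_apply, zero_mul]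
  | zero =>
    cases j with
    | succ j => rw [b.ε_succ, LinearMap.zero_apply, mul_zero]
    | zero => omega

/-- The tensor product of two augmentations. -/
noncomputable def Augmentation.tensor : Augmentation (tensorComplex.obj (K, L)) where
  ε n := ULift.moduleEquiv.toLinearMap ∘ₗ (tensorAugHom a b n).hom
  ε_succ n := by
    have h : tensorAugHom a b (n + 1) = 0 := tensorComplex_hom_ext fun i j hij x y => by
      rw [tensorAugHom_tmul, Augmentation.mul_eq_zero a b hij]
      rfl
    rw [h]
    rfl
  ε_d n m x := by
    have h := congrArg (fun t => t.hom x) (d_tensorAugHom a b n m)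
    exact congrArg ULift.down h

theorem Augmentation.tensor_tmul {i j n : ℕ} (h : i + j = n) (x : K.X i) (y : L.X j) :
    (a.tensor b).ε n (tmul K L h x y) = a.ε i x * b.ε j y :=
  congrArg ULift.down (tensorAugHom_tmul a b h x y)

theorem tensorComplex_map_tmul {K' L' : ChainComplex (ModuleCat.{w} ℤ) ℕ} (f : K ⟶ K')
    (g : L ⟶ L') {i j n : ℕ} (h : i + j = n) (x : K.X i) (y : L.X j) :
    (tensorComplex.map (X := (K, L)) (Y := (K', L')) (f, g)).f n (tmul K L h x y) =
      tmul K' L' h (f.f i x) (g.f j y) := by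
  have h1 := congrArg (fun t => t.hom (x ⊗ₜ[ℤ] y)) (ι_mapBifunctorMap f (𝟙 L) (tensorMod ℤ)
    (ComplexShape.down ℕ) i j n h)
  have h2 := congrArg (fun t => t.hom (f.f i x ⊗ₜ[ℤ] y)) (ι_mapBifunctorMap (𝟙 K') g (tensorMod ℤ)
    (ComplexShape.down ℕ) i j n h)
  exact (congrArg ((mapBifunctorMap (𝟙 K') g (tensorMod ℤ) (ComplexShape.down ℕ)).f n) h1).trans h2

theorem Augmentation.tensor_natural {K' L' : ChainComplex (ModuleCat.{w} ℤ) ℕ}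
    (a' : Augmentation K') (b' : Augmentation L') (f : K ⟶ K') (g : L ⟶ L')
    (hf : ∀ x, a'.ε 0 (f.f 0 x) = a.ε 0 x) (hg : ∀ x, b'.ε 0 (g.f 0 x) = b.ε 0 x)
    (x : (tensorComplex.obj (K, L)).X 0) :
    (a'.tensor b').ε 0 ((tensorComplex.map (X := (K, L)) (Y := (K', L')) (f, g)).f 0 x) =
      (a.tensor b).ε 0 x := by
  have h : (tensorComplex.map (X := (K, L)) (Y := (K', L')) (f, g)).f 0 ≫ tensorAugHom a' b' 0 =
      tensorAugHom a b 0 := by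
    refine tensorComplex_hom_ext fun i j hij x y => ?_
    obtain ⟨rfl, rfl⟩ : i = 0 ∧ j = 0 := by omega
    refine (congrArg (tensorAugHom a' b' 0) (tensorComplex_map_tmul f g hij x y)).trans ?_
    rw [tensorAugHom_tmul, tensorAugHom_tmul, hf, hg]
  exact congrArg (fun t => (t.hom x).down) h

-- Deform one factor at a time: `1 ⊗ 1 ≃ p ⊗ 1 ≃ p ⊗ q`, where `p` and `q` factor through the
-- augmentations; `p ⊗ q` then factors through their product.
variable {a b} in
theorem Augmentation.Contractible.tensor (ha : a.Contractible) (hb : b.Contractible) :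
    (a.tensor b).Contractible := by
  obtain ⟨v, hv, ⟨h⟩⟩ := ha
  obtain ⟨w, hw, ⟨k⟩⟩ := hb
  -- Above degree `0` the augmentation vanishes, so the values there are immaterial.
  let z : ∀ n, (tensorComplex.obj (K, L)).X n
    | 0 => tmul K L rfl (v 0) (w 0)
    | _ + 1 => 0
  refine ⟨z, ?_, ⟨?_⟩⟩
  · change (a.tensor b).ε 0 (tmul K L rfl (v 0) (w 0)) = 1
    rw [Augmentation.tensor_tmul, hv, hw, mul_one]
  have h₁ : 𝟙 (tensorComplex.obj (K, L)) =
      mapBifunctorMap (𝟙 K) (𝟙 L) (tensorMod ℤ) (ComplexShape.down ℕ) := by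
    refine Eq.trans (tensorComplex.map_id (K, L)).symm ?_
    ext n : 1
    refine tensorComplex_hom_ext fun i j hij x y => ?_
    refine (tensorComplex_map_tmul (𝟙 K) (𝟙 L) hij x y).trans ?_
    exact (congrArg (fun t => t.hom (x ⊗ₜ[ℤ] y)) (ι_mapBifunctorMap (𝟙 K) (𝟙 L) (tensorMod ℤ)
      (ComplexShape.down ℕ) i j n hij)).symm
  have h₂ : mapBifunctorMap (a.pointMap v) (b.pointMap w) (tensorMod ℤ) (ComplexShape.down ℕ) =
      (a.tensor b).pointMap z := by
    ext n : 1
    refine tensorComplex_hom_ext fun i j hij x y => ?_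
    refine (congrArg (fun t => t.hom (x ⊗ₜ[ℤ] y)) (ι_mapBifunctorMap (a.pointMap v)
      (b.pointMap w) (tensorMod ℤ) (ComplexShape.down ℕ) i j n hij)).trans ?_
    refine (map_toSpanSingleton_tmul (ιMapBifunctor K L (tensorMod ℤ) (ComplexShape.down ℕ)
      i j n hij).hom (v i) (w j) (a.ε i x) (b.ε j y)).trans ?_
    change LinearMap.toSpanSingleton ℤ ((tensorComplex.obj (K, L)).X n)
      (tmul K L hij (v i) (w j)) _ = LinearMap.toSpanSingleton ℤ
        ((tensorComplex.obj (K, L)).X n) (z n) ((a.tensor b).ε n (tmul K L hij x y))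
    rw [Augmentation.tensor_tmul]
    cases n with
    | zero =>
      obtain ⟨rfl, rfl⟩ : i = 0 ∧ j = 0 := by omega
      rfl
    | succ n => rw [Augmentation.mul_eq_zero a b hij, map_zero, map_zero]
  exact (Homotopy.ofEq h₁).trans (((mapBifunctorMapHomotopy₁ h (𝟙 L) _ _).trans
    (mapBifunctorMapHomotopy₂ (a.pointMap v) k _ _)).trans (Homotopy.ofEq h₂))

end Tensor

/-! ### Maps of closure spaces -/

namespace CMap

variable {X : Type u} {Y : Type v} {Z : Type w} [ClosureSpace X] [ClosureSpace Y] [ClosureSpace Z]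

/-- The constant map. -/
def const (X : Type u) [ClosureSpace X] (y : Y) : CMap X Y :=
  ⟨fun _ => y, cont_iff.mpr fun _ => Filter.tendsto_const_pure.mono_right (pure_le_nhd y)⟩

/-- The map to a product with given components. -/
def pair (f : CMap Z X) (g : CMap Z Y) : CMap Z (X × Y) :=
  ⟨fun z => (f.toFun z, g.toFun z), cont_iff.mpr fun z => by
    rw [nhd_prod]
    exact (cont_iff.mp f.cont z).prodMk (cont_iff.mp g.cont z)⟩

/-- The first projection. -/
def fst (X : Type u) (Y : Type v) [ClosureSpace X] [ClosureSpace Y] : CMap (X × Y) X :=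
  ⟨Prod.fst, cont_iff.mpr fun z => by
    rw [nhd_prod]
    exact Filter.tendsto_fst⟩

/-- The second projection. -/
def snd (X : Type u) (Y : Type v) [ClosureSpace X] [ClosureSpace Y] : CMap (X × Y) Y :=
  ⟨Prod.snd, cont_iff.mpr fun z => by
    rw [nhd_prod]
    exact Filter.tendsto_snd⟩

/-- The map to a product of a family with given components. -/
def pi {ι : Type w} {A : ι → Type v} [∀ i, ClosureSpace (A i)] (f : ∀ i, CMap X (A i)) :
    CMap X (∀ i, A i) :=
  ⟨fun x i => (f i).toFun x, cont_iff.mpr fun x => by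
    rw [nhd_pi]
    exact Filter.tendsto_pi.mpr fun i => cont_iff.mp (f i).cont x⟩

/-- A coordinate projection. -/
def eval {ι : Type w} {A : ι → Type v} [∀ i, ClosureSpace (A i)] (i : ι) : CMap (∀ i, A i) (A i) :=
  ⟨fun x => x i, cont_iff.mpr fun x => by
    rw [nhd_pi]
    exact Filter.tendsto_eval_pi _ i⟩

end CMap

/-! ### Small models as objects of the ambient universe, and representability. -/

namespace Cl

/-- A closure space in a larger universe. -/
def ulift (S : Cl.{0}) : Cl.{u} where
  carrier := ULift.{u} S
  str :=
    { cl := fun A => ULift.down ⁻¹' cl (ULift.up ⁻¹' A)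
      cl_empty := by simp [cl_empty]
      subset_cl := fun A x hx => subset_cl (ULift.up ⁻¹' A) hx
      cl_union := fun A B => by rw [Set.preimage_union, cl_union, Set.preimage_union] }

/-- The canonical homeomorphism to the lifted space. -/
def up (S : Cl.{0}) : CMap S (ulift.{u} S) where
  toFun := ULift.up
  cont := by
    rintro A _ ⟨x, hx, rfl⟩
    refine cl_mono (B := ULift.up ⁻¹' (ULift.up '' A)) ?_ hx
    exact Set.subset_preimage_image _ _

/-- The canonical homeomorphism from the lifted space. -/
def down (S : Cl.{0}) : CMap (ulift.{u} S) S where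
  toFun := ULift.down
  cont := by
    rintro A _ ⟨x, hx, rfl⟩
    refine cl_mono (A := ULift.up ⁻¹' A) ?_ hx
    exact fun y hy => ⟨ULift.up y, hy, rfl⟩

/-- The functor of continuous maps from a fixed space. -/
def mapsFrom (S : Cl.{0}) : Cl.{u} ⥤ Type u where
  obj X := CMap S X
  map f := TypeCat.ofHom fun σ => CMap.comp f σ

/-- Continuous maps from a small space are represented by the lifted space. -/
def mapsFromIso (S : Cl.{0}) : mapsFrom.{u} S ≅ coyoneda.obj (Opposite.op (ulift S)) :=
  NatIso.ofComponents
    (fun X =>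
      { hom := TypeCat.ofHom fun (σ : CMap S X) => (CMap.comp σ (down S) : CMap (ulift S) X)
        inv := TypeCat.ofHom fun (σ : CMap (ulift S) X) => CMap.comp σ (up S) })
    (fun _ => rfl)

/-- Maps to a product are pairs of maps. -/
def prodCoyonedaIso (M : Cl.{u}) :
    prodFunctor ⋙ coyoneda.obj (Opposite.op M) ≅
      coyoneda.obj (Opposite.op ((M, M) : Cl.{u} × Cl.{u})) :=
  NatIso.ofComponents
    (fun X =>
      { hom := TypeCat.ofHom fun (σ : CMap M (X.1 × X.2)) =>
          ((⟨(CMap.fst X.1 X.2).comp σ, (CMap.snd X.1 X.2).comp σ⟩ :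
            (M ⟶ X.1) × (M ⟶ X.2)))
        inv := TypeCat.ofHom fun σ : (M ⟶ X.1) × (M ⟶ X.2) => CMap.pair σ.1 σ.2 })
    (fun _ => rfl)

/-- A retract of a free functor on closure spaces, evaluated on products, is a retract of a free
functor. -/
noncomputable def retractProd {P : Cl.{u} ⥤ ModuleCat.{u} ℤ} {M : Cl.{u}}
    (r : Retract P (freeOn M)) :
    Retract (prodFunctor ⋙ P) (freeOn (C := Cl.{u} × Cl.{u}) (M, M)) :=
  (r.map ((Functor.whiskeringLeft _ _ _).obj prodFunctor)).trans
    (Retract.ofIso (Functor.isoWhiskerRight (prodCoyonedaIso M) (freeMod ℤ)))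

end Cl

/-- The Eilenberg–Zilber theorem for a functor from closure spaces to chain complexes whose
components are retracts of free functors on models with contractible binary products. -/
theorem eilenbergZilber (F : Cl.{u} ⥤ ChainComplex (ModuleCat.{u} ℤ) ℕ) (M : ℕ → Cl.{u})
    (r : ∀ n, Retract ((degreewise F).X n) (freeOn (M n)))
    (a : ∀ X, Augmentation (F.obj X))
    (na : ∀ {X Y : Cl.{u}} (f : X ⟶ Y) (x : (F.obj X).X 0),
      (a Y).ε 0 ((F.map f).f 0 x) = (a X).ε 0 x)
    (c : ∀ n, (a (M n)).Contractible)
    (cp : ∀ i j, (a (Cl.prodFunctor.obj (M i, M j))).Contractible) :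
    Nonempty (NaturalHomotopyEquiv (Cl.prodFunctor ⋙ F) (F.prod F ⋙ tensorComplex)) := by
  -- The product side is projective already relative to the diagonal pairs; the tensor side needs
  -- all pairs, so both must be acyclic on all of them.
  refine nonempty_naturalHomotopyEquiv (𝓜 := fun X => ∃ i j, X = (M i, M j))
    (fun n => ?_) (fun n => ?_) (fun X => a _) (fun X => (a X.1).tensor (a X.2))
    (fun f x => na _ x) (fun f x => ?_) ?_ ?_
  · exact (relProj_freeOn ⟨n, n, rfl⟩).of_retract (Cl.retractProd (r n))
  · refine relProj_tensor F F (fun i j => ?_) n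
    exact (relProj_freeOn ⟨i, j, rfl⟩).of_retract
      ((retractBoxTensor (r i) (r j)).trans (Retract.ofIso (boxTensorFreeOn _ _)))
  · exact Augmentation.tensor_natural _ _ _ _ (F.map f.1) (F.map f.2) (na f.1) (na f.2) x
  · rintro _ ⟨i, j, rfl⟩
    exact (cp i j).exact
  · rintro _ ⟨i, j, rfl⟩
    exact ((c i).tensor (c j)).exact

/-! ### Simplicial chains -/

section Simplicial

open Simplicial

variable {J : Interval} {X Y : Cl.{u}}

/-- The face of a singular simplex opposite to the vertex `i`. -/
noncomputable def simplexFace {n : ℕ} (i : Fin (n + 2)) (σ : CMap (J.simplex.obj ⦋n + 1⦌) X) :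
    CMap (J.simplex.obj ⦋n⦌) X :=
  σ.comp (J.simplex.map (SimplexCategory.δ i))

/-- The boundary of simplicial chains. -/
noncomputable def simplicialBoundary (J : Interval) (X : Cl.{u}) (n : ℕ) :
    (CMap (J.simplex.obj ⦋n + 1⦌) X →₀ ℤ) →ₗ[ℤ] (CMap (J.simplex.obj ⦋n⦌) X →₀ ℤ) :=
  ∑ i : Fin (n + 2), (-1 : ℤ) ^ i.val • Finsupp.lmapDomain ℤ ℤ (simplexFace i)

theorem simplicialBoundary_single (n : ℕ) (σ : CMap (J.simplex.obj ⦋n + 1⦌) X) :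
    simplicialBoundary J X n (Finsupp.single σ 1) =
      ∑ i : Fin (n + 2), (-1 : ℤ) ^ i.val • Finsupp.single (simplexFace i σ) 1 := by
  simp [simplicialBoundary, LinearMap.sum_apply]

theorem simplicialChains_d (J : Interval) (X : Cl.{u}) (n : ℕ) :
    (((simplicialChains J).obj X).d (n + 1) n).hom = simplicialBoundary J X n := by
  refine Finsupp.lhom_ext' fun σ => LinearMap.ext_ring ?_
  refine Eq.trans ?_ (simplicialBoundary_single n σ).symm
  let ev : (((simplicialChains J).obj X).X (n + 1) ⟶ ((simplicialChains J).obj X).X n) →+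
      (CMap (J.simplex.obj ⦋n⦌) X →₀ ℤ) :=
    { toFun := fun t => t.hom (Finsupp.single σ (1 : ℤ))
      map_zero' := rfl
      map_add' := fun _ _ => rfl }
  have h := AlgebraicTopology.AlternatingFaceMapComplex.obj_d_eq
    (((SimplicialObject.whiskering _ _).obj (freeMod ℤ)).obj ((nerve J).obj X)) n
  refine (congrArg ev h).trans ((map_sum ev _ _).trans ?_)
  refine Finset.sum_congr rfl fun i _ => (map_zsmul ev _ _).trans ?_
  exact congrArg _ Finsupp.mapDomain_single

variable (J) in
theorem simplicialChains_map_single (f : X ⟶ Y) (n : ℕ) (σ : CMap (J.simplex.obj ⦋n⦌) X) :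
    ((simplicialChains J).map f).f n (Finsupp.single σ (1 : ℤ)) =
      (Finsupp.single (CMap.comp f σ) (1 : ℤ) : CMap (J.simplex.obj ⦋n⦌) Y →₀ ℤ) :=
  Finsupp.mapDomain_single

/-- The sum of the coefficients. -/
noncomputable def coeffSum (S : Type u) : (S →₀ ℤ) →ₗ[ℤ] ℤ :=
  Finsupp.lift ℤ ℤ S fun _ => 1

theorem coeffSum_single {S : Type u} (s : S) : coeffSum S (Finsupp.single s 1) = 1 :=
  lift_single_one _ s

/-- The augmentation of the simplicial chains. -/
noncomputable def simplicialAug (J : Interval) (X : Cl.{u}) :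
    Augmentation ((simplicialChains J).obj X) where
  ε
    | 0 => coeffSum (CMap (J.simplex.obj ⦋0⦌) X)
    | _ + 1 => 0
  ε_succ _ := rfl
  ε_d i j x := by
    by_cases hij : j + 1 = i
    · subst hij
      cases j with
      | succ j => rfl
      | zero =>
        have h : coeffSum (CMap (J.simplex.obj ⦋0⦌) X) ∘ₗ simplicialBoundary J X 0 = 0 := by
          refine Finsupp.lhom_ext' fun σ => LinearMap.ext_ring ?_
          change coeffSum _ (simplicialBoundary J X 0 (Finsupp.single σ 1)) = 0
          simp [simplicialBoundary_single, Fin.sum_univ_two, coeffSum_single]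
        rw [← simplicialChains_d] at h
        exact LinearMap.congr_fun h x
    · rw [HomologicalComplex.shape _ i j hij]
      exact map_zero _

theorem simplicialAug_natural (f : X ⟶ Y) (x : ((simplicialChains J).obj X).X 0) :
    (simplicialAug J Y).ε 0 (((simplicialChains J).map f).f 0 x) = (simplicialAug J X).ε 0 x := by
  have h : coeffSum (CMap (J.simplex.obj ⦋0⦌) Y) ∘ₗ (((simplicialChains J).map f).f 0).hom =
      coeffSum (CMap (J.simplex.obj ⦋0⦌) X) := by
    refine Finsupp.lhom_ext' fun σ => LinearMap.ext_ring ?_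
    refine (congrArg (coeffSum _) (simplicialChains_map_single J f 0 σ)).trans ?_
    exact (coeffSum_single _).trans (coeffSum_single _).symm
  exact LinearMap.congr_fun h x

/-- Simplicial chains are free on the lifted simplices. -/
noncomputable def simplicialChainsRetract (J : Interval) (n : ℕ) :
    Retract ((degreewise (simplicialChains.{u} J)).X n)
      (freeOn (Cl.ulift (J.simplex.obj ⦋n⦌))) :=
  Retract.ofIso ((NatIso.ofComponents (fun _ => Iso.refl _) (fun _ => rfl) :
    (degreewise (simplicialChains.{u} J)).X n ≅
      Cl.mapsFrom (J.simplex.obj ⦋n⦌) ⋙ freeMod ℤ) ≪≫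
    Functor.isoWhiskerRight (Cl.mapsFromIso _) (freeMod ℤ))

/-- A contraction of the singular simplices of a space to a point by a cone construction. -/
structure Coning (J : Interval) (X : Cl.{u}) where
  apex : X
  cone : ∀ n, CMap (J.simplex.obj ⦋n⦌) X → CMap (J.simplex.obj ⦋n + 1⦌) X
  face_zero : ∀ n σ, simplexFace 0 (cone n σ) = σ
  face_one : ∀ σ, simplexFace 1 (cone 0 σ) = CMap.const _ apex
  face_succ : ∀ n i σ, simplexFace (Fin.succ i) (cone (n + 1) σ) = cone n (simplexFace i σ)

/-- Cones in a product are formed componentwise. -/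
noncomputable def Coning.prod (c : Coning J X) (d : Coning J Y) :
    Coning J (Cl.prodFunctor.obj (X, Y)) where
  apex := (c.apex, d.apex)
  cone n σ := CMap.pair (c.cone n ((CMap.fst X Y).comp σ)) (d.cone n ((CMap.snd X Y).comp σ))
  face_zero n σ := congrArg₂ CMap.pair (c.face_zero n ((CMap.fst X Y).comp σ))
    (d.face_zero n ((CMap.snd X Y).comp σ))
  face_one σ := congrArg₂ CMap.pair (c.face_one ((CMap.fst X Y).comp σ))
    (d.face_one ((CMap.snd X Y).comp σ))
  face_succ n i σ := congrArg₂ CMap.pair (c.face_succ n i ((CMap.fst X Y).comp σ))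
    (d.face_succ n i ((CMap.snd X Y).comp σ))

/-- Cones in a lifted space. -/
noncomputable def Coning.ulift {S : Cl.{0}} (c : Coning J S) : Coning J (Cl.ulift.{u} S) where
  apex := ULift.up c.apex
  cone n σ := (Cl.up S).comp (c.cone n ((Cl.down S).comp σ))
  face_zero n σ := congrArg (Cl.up S).comp (c.face_zero n ((Cl.down S).comp σ))
  face_one σ := congrArg (Cl.up S).comp (c.face_one ((Cl.down S).comp σ))
  face_succ n i σ := congrArg (Cl.up S).comp (c.face_succ n i ((Cl.down S).comp σ))

/-- The face `0` of a cone is the original simplex and the other faces are cones on its faces with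
shifted sign, so `∂ ∘ cone = id - cone ∘ ∂`. In degree `0` the correction term is the apex, which is
the map through the augmentation. -/
theorem Coning.contractible (c : Coning J X) : (simplicialAug J X).Contractible := by
  refine Augmentation.contractible_of_maps _
    (fun n => (Finsupp.single (CMap.const _ c.apex) (1 : ℤ) : CMap (J.simplex.obj ⦋n⦌) X →₀ ℤ))
    (coeffSum_single _) (fun n => Finsupp.lmapDomain ℤ ℤ (c.cone n)) ?_ ?_
  · have h : LinearMap.id = simplicialBoundary J X 0 ∘ₗ Finsupp.lmapDomain ℤ ℤ (c.cone 0) +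
        LinearMap.toSpanSingleton ℤ _ (Finsupp.single (CMap.const _ c.apex) (1 : ℤ)) ∘ₗ
          coeffSum (CMap (J.simplex.obj ⦋0⦌) X) := by
      refine Finsupp.lhom_ext' fun σ => LinearMap.ext_ring ?_
      change Finsupp.single σ 1 = simplicialBoundary J X 0 (Finsupp.mapDomain (c.cone 0)
        (Finsupp.single σ 1)) + LinearMap.toSpanSingleton ℤ _ _ (coeffSum _ (Finsupp.single σ 1))
      rw [Finsupp.mapDomain_single, simplicialBoundary_single, coeffSum_single,
        Fin.sum_univ_two, c.face_zero, c.face_one]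
      simp
    rw [← simplicialChains_d] at h
    exact fun x => LinearMap.congr_fun h x
  · intro n
    have h : LinearMap.id = Finsupp.lmapDomain ℤ ℤ (c.cone n) ∘ₗ simplicialBoundary J X n +
        simplicialBoundary J X (n + 1) ∘ₗ Finsupp.lmapDomain ℤ ℤ (c.cone (n + 1)) := by
      refine Finsupp.lhom_ext' fun σ => LinearMap.ext_ring ?_
      change Finsupp.single σ 1 = Finsupp.lmapDomain ℤ ℤ (c.cone n)
        (simplicialBoundary J X n (Finsupp.single σ 1)) + simplicialBoundary J X (n + 1)
          (Finsupp.mapDomain (c.cone (n + 1)) (Finsupp.single σ 1))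
      rw [Finsupp.mapDomain_single, simplicialBoundary_single, simplicialBoundary_single,
        Fin.sum_univ_succ (n := n + 2), c.face_zero, map_sum]
      simp only [c.face_succ, Fin.val_succ, pow_succ, Fin.val_zero, pow_zero, one_smul, map_smul,
        Finsupp.lmapDomain_apply, Finsupp.mapDomain_single, mul_neg_one, neg_smul,
        Finset.sum_neg_distrib]
      abel
    rw [← simplicialChains_d, ← simplicialChains_d] at h
    exact fun x => LinearMap.congr_fun h x

end Simplicial

/-! ### Cones on the simplices -/

section Cones

open Simplicial

theorem cont_top_iff {X : Type u} {Y : Type v} [TopologicalSpace X] [TopologicalSpace Y]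
    {f : X → Y} : @Cont X Y (topClosure X) (topClosure Y) f ↔ Continuous f := by
  refine ⟨fun h => ?_, fun h A => image_closure_subset_closure_image h⟩
  refine continuous_iff_isClosed.mpr fun s hs => isClosed_of_closure_subset fun x hx => ?_
  have h1 : f x ∈ closure (f '' (f ⁻¹' s)) := h _ ⟨x, hx, rfl⟩
  exact hs.closure_subset_iff.mpr (Set.image_preimage_subset f s) h1

theorem cont_up_iff {X : Type u} {Y : Type v} [Preorder X] [Preorder Y]
    {f : X → Y} : @Cont X Y (upClosure X) (upClosure Y) f ↔ Monotone f := by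
  constructor
  · intro h i j hij
    obtain ⟨_, ⟨k, rfl, rfl⟩, hk⟩ := h {i} ⟨j, ⟨i, rfl, hij⟩, rfl⟩
    exact hk
  · rintro h A _ ⟨j, ⟨i, hi, hij⟩, rfl⟩
    exact ⟨_, ⟨i, hi, rfl⟩, h hij⟩

/-- A set with a point in its closure is nonempty because `cl ∅ = ∅`. -/
theorem cont_indiscrete {X : Type u} {Y : Type v} [ClosureSpace X] (f : X → Y) :
    @Cont X Y _ (indiscreteClosure Y) f := by
  rintro A _ ⟨x, hx, rfl⟩
  refine Set.Nonempty.image f (Set.nonempty_iff_ne_empty.mpr ?_)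
  rintro rfl
  rw [cl_empty] at hx
  exact hx

theorem monotone_cons_zero {n m : ℕ} {f : Fin n → Fin (m + 1)} (hf : Monotone f) :
    Monotone (Fin.cons 0 f : Fin (n + 1) → Fin (m + 1)) := by
  intro i j hij
  induction i using Fin.cases with
  | zero => exact Fin.zero_le _
  | succ i =>
    induction j using Fin.cases with
    | zero => exact absurd hij (by simp)
    | succ j => exact hf (Fin.succ_le_succ_iff.mp hij)

/-- Omitting a vertex other than the apex commutes with adjoining the apex; this gives `face_succ`
for both finite intervals. -/
theorem cons_comp_succ_succAbove {A : Type*} {n : ℕ} (a : A) (f : Fin (n + 2) → A)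
    (i : Fin (n + 2)) (x : Fin (n + 2)) :
    (Fin.cons a f : Fin (n + 3) → A) (i.succ.succAbove x) =
      (Fin.cons a (fun y => f (i.succAbove y)) : Fin (n + 2) → A) x := by
  induction x using Fin.cases <;> simp

/-- The cone over simplices of `|Δᵐ|^{J₊}` with the least vertex as apex. -/
noncomputable def coningJPlus (m : ℕ) : Coning .JPlus (Interval.JPlus.simplex.obj ⦋m⦌) where
  apex := (0 : Fin (m + 1))
  cone n σ :=
    @CMap.mk (Fin (n + 2)) (Fin (m + 1)) (upClosure _) (upClosure _)
      (Fin.cons 0 (σ.toFun : Fin (n + 1) → Fin (m + 1)))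
      (cont_up_iff.mpr (monotone_cons_zero (cont_up_iff.mp σ.cont)))
  face_zero n σ := CMap.ext (funext fun (x : Fin (n + 1)) => rfl)
  face_one σ := CMap.ext (funext fun (x : Fin 1) => by
    obtain rfl := Subsingleton.elim x 0
    rfl)
  face_succ n i σ := CMap.ext (funext fun (x : Fin (n + 2)) =>
    cons_comp_succ_succAbove (0 : Fin (m + 1)) (σ.toFun : Fin (n + 2) → Fin (m + 1)) i x)

/-- The cone over simplices of the indiscrete space `|Δᵐ|^{J₁}`. -/
noncomputable def coningJOne (m : ℕ) : Coning .JOne (Interval.JOne.simplex.obj ⦋m⦌) where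
  apex := (0 : Fin (m + 1))
  cone n σ :=
    @CMap.mk (Fin (n + 2)) (Fin (m + 1)) (indiscreteClosure _) (indiscreteClosure _)
      (Fin.cons 0 (σ.toFun : Fin (n + 1) → Fin (m + 1)))
      (@cont_indiscrete _ _ (indiscreteClosure _) _)
  face_zero n σ := CMap.ext (funext fun (x : Fin (n + 1)) => rfl)
  face_one σ := CMap.ext (funext fun (x : Fin 1) => by
    obtain rfl := Subsingleton.elim x 0
    rfl)
  face_succ n i σ := CMap.ext (funext fun (x : Fin (n + 2)) =>
    cons_comp_succ_succAbove (0 : Fin (m + 1)) (σ.toFun : Fin (n + 2) → Fin (m + 1)) i x)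

/-! ### Straight-line cones in the topological simplex. -/

variable {n m : ℕ}

/-- The projection of a simplex from its first vertex to the opposite face, with an arbitrary value
at the first vertex. -/
noncomputable def simplexTail (t : stdSimplex ℝ (Fin (n + 2))) : stdSimplex ℝ (Fin (n + 1)) :=
  if h : t 0 = 1 then stdSimplex.vertex 0 else
    ⟨fun i => t i.succ / (1 - t 0), fun i => div_nonneg (stdSimplex.zero_le t _)
      (sub_nonneg.mpr (stdSimplex.le_one t 0)), by
      rw [← Finset.sum_div, div_eq_one_iff_eq (sub_ne_zero.mpr (Ne.symm h))]
      have := stdSimplex.sum_eq_one t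
      rw [Fin.sum_univ_succ] at this
      linarith⟩

theorem simplexTail_apply {t : stdSimplex ℝ (Fin (n + 2))} (h : t 0 ≠ 1) (i : Fin (n + 1)) :
    simplexTail t i = t i.succ / (1 - t 0) := by
  rw [simplexTail, dif_neg h]
  rfl

/-- The cone with apex `v` over a singular simplex of `Δᵐ`. -/
noncomputable def topCone (v : stdSimplex ℝ (Fin (m + 1)))
    (f : stdSimplex ℝ (Fin (n + 1)) → stdSimplex ℝ (Fin (m + 1)))
    (t : stdSimplex ℝ (Fin (n + 2))) : stdSimplex ℝ (Fin (m + 1)) :=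
  ⟨t 0 • (v : Fin (m + 1) → ℝ) + (1 - t 0) • (f (simplexTail t) : Fin (m + 1) → ℝ),
    convex_stdSimplex ℝ _ v.2 (f (simplexTail t)).2 (stdSimplex.zero_le t 0)
      (sub_nonneg.mpr (stdSimplex.le_one t 0)) (by ring)⟩

theorem topCone_apply (v : stdSimplex ℝ (Fin (m + 1)))
    (f : stdSimplex ℝ (Fin (n + 1)) → stdSimplex ℝ (Fin (m + 1)))
    (t : stdSimplex ℝ (Fin (n + 2))) (k : Fin (m + 1)) :
    topCone v f t k = t 0 * v k + (1 - t 0) * f (simplexTail t) k := rfl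

theorem continuous_stdSimplex_apply (k : Fin n) :
    Continuous fun t : stdSimplex ℝ (Fin n) => t k :=
  (continuous_apply k).comp continuous_subtype_val

/-- Away from the first vertex the tail is a continuous quotient. At that vertex the tail need not
be continuous, but its contribution is squeezed to zero: the coordinates of `f` lie in `[0, 1]` and
the weight `1 - t 0` tends to zero. -/
theorem continuous_topCone (v : stdSimplex ℝ (Fin (m + 1)))
    {f : stdSimplex ℝ (Fin (n + 1)) → stdSimplex ℝ (Fin (m + 1))} (hf : Continuous f) :
    Continuous (topCone v f) := by
  refine Continuous.subtype_mk (continuous_pi fun k => ?_) _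
  change Continuous fun t : stdSimplex ℝ (Fin (n + 2)) =>
    t 0 * v k + (1 - t 0) * f (simplexTail t) k
  have h0 := continuous_stdSimplex_apply (0 : Fin (n + 2))
  refine (h0.mul continuous_const).add (continuous_iff_continuousAt.mpr fun t => ?_)
  by_cases ht : t 0 = 1
  · have h1 : Filter.Tendsto (fun s : stdSimplex ℝ (Fin (n + 2)) => 1 - s 0) (nhds t) (nhds 0) := by
      have h2 : Filter.Tendsto (fun s : stdSimplex ℝ (Fin (n + 2)) => 1 - s 0) (nhds t)
          (nhds (1 - t 0)) := (continuous_const.sub h0).tendsto t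
      rwa [ht, sub_self] at h2
    change Filter.Tendsto _ _ (nhds ((1 - t 0) * f (simplexTail t) k))
    rw [ht, sub_self, zero_mul]
    refine squeeze_zero (fun s => mul_nonneg (sub_nonneg.mpr (stdSimplex.le_one s 0))
      (stdSimplex.zero_le _ _)) (fun s => ?_) h1
    exact mul_le_of_le_one_right (sub_nonneg.mpr (stdSimplex.le_one s 0)) (stdSimplex.le_one _ _)
  · have hopen : ∀ᶠ s : stdSimplex ℝ (Fin (n + 2)) in nhds t, s 0 ≠ 1 :=
      h0.continuousAt.eventually_ne ht
    have htail : ContinuousAt (simplexTail (n := n)) t := by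
      refine Topology.IsInducing.subtypeVal.continuousAt_iff.mpr (continuousAt_pi.mpr fun i => ?_)
      refine ContinuousAt.congr (f := fun s : stdSimplex ℝ (Fin (n + 2)) => s i.succ / (1 - s 0))
        ?_ (hopen.mono fun s hs => (simplexTail_apply hs i).symm)
      exact (continuous_stdSimplex_apply i.succ).continuousAt.div
        (continuous_const.sub h0).continuousAt (sub_ne_zero.mpr (Ne.symm ht))
    exact (continuous_const.sub h0).continuousAt.mul
      (((continuous_stdSimplex_apply k).comp hf).continuousAt.comp htail)

theorem stdSimplex_map_apply {p q : ℕ} (g : Fin p → Fin q) (t : stdSimplex ℝ (Fin p))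
    (j : Fin q) : stdSimplex.map g t j = ∑ x, if g x = j then t x else 0 := by
  rw [stdSimplex.map_coe, FunOnFinite.linearMap_apply_apply, Finset.sum_filter]

theorem topCone_face_zero (v : stdSimplex ℝ (Fin (m + 1)))
    (f : stdSimplex ℝ (Fin (n + 1)) → stdSimplex ℝ (Fin (m + 1)))
    (t : stdSimplex ℝ (Fin (n + 1))) :
    topCone v f (stdSimplex.map (Fin.succAbove 0) t) = f t := by
  have h0 : stdSimplex.map (Fin.succAbove 0) t 0 = 0 := by
    simp [stdSimplex_map_apply]
  have h1 : simplexTail (stdSimplex.map (Fin.succAbove 0) t) = t := by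
    ext i
    rw [simplexTail_apply (by rw [h0]; exact zero_ne_one), h0]
    simp [stdSimplex_map_apply]
  ext k
  rw [topCone_apply, h0, h1]
  ring

theorem topCone_face_one (v : stdSimplex ℝ (Fin (m + 1)))
    (f : stdSimplex ℝ (Fin 1) → stdSimplex ℝ (Fin (m + 1))) (t : stdSimplex ℝ (Fin 1)) :
    topCone v f (stdSimplex.map (Fin.succAbove 1) t) = v := by
  -- The face of `Δ¹` opposite vertex `1` is the single point vertex `0`, where all the weight is on
  -- the apex.
  have h0 : stdSimplex.map (Fin.succAbove 1) t 0 = 1 := by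
    rw [stdSimplex_map_apply, Fintype.sum_unique]
    exact (if_pos rfl).trans (stdSimplex.eq_one_of_unique t _)
  ext k
  rw [topCone_apply, h0]
  ring

/-- These face maps preserve the first coordinate and commute with projection from the first vertex.
When `t 0 = 1` the projection is not meaningful, but both sides equal `v`. -/
theorem topCone_face_succ (v : stdSimplex ℝ (Fin (m + 1)))
    (f : stdSimplex ℝ (Fin (n + 2)) → stdSimplex ℝ (Fin (m + 1))) (i : Fin (n + 2))
    (t : stdSimplex ℝ (Fin (n + 2))) :
    topCone v f (stdSimplex.map (Fin.succAbove i.succ) t) =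
      topCone v (fun s => f (stdSimplex.map (Fin.succAbove i) s)) t := by
  have h0 : stdSimplex.map (Fin.succAbove i.succ) t 0 = t 0 := by
    simp [stdSimplex_map_apply, Fin.sum_univ_succ]
  ext k
  rw [topCone_apply, topCone_apply, h0]
  by_cases ht : t 0 = 1
  · rw [ht]
    ring
  · have h1 : simplexTail (stdSimplex.map (Fin.succAbove i.succ) t) =
        stdSimplex.map (Fin.succAbove i) (simplexTail t) := by
      ext j
      rw [simplexTail_apply (by rwa [h0]), h0, stdSimplex_map_apply, stdSimplex_map_apply,
        Fin.sum_univ_succ]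
      simp only [Fin.succ_succAbove_zero, Fin.succ_succAbove_succ, Fin.succ_inj,
        simplexTail_apply ht]
      rw [if_neg (Fin.succ_ne_zero j).symm, zero_add, Finset.sum_div]
      refine Finset.sum_congr rfl fun x _ => ?_
      rw [ite_div, zero_div]
    rw [h1]

/-- The cone over singular simplices of the topological simplex `Δᵐ`. -/
noncomputable def coningI (m : ℕ) : Coning .I (Interval.I.simplex.obj ⦋m⦌) where
  apex := (stdSimplex.vertex 0 : stdSimplex ℝ (Fin (m + 1)))
  cone n σ :=
    @CMap.mk (stdSimplex ℝ (Fin (n + 2))) (stdSimplex ℝ (Fin (m + 1))) (topClosure _)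
      (topClosure _) (topCone (stdSimplex.vertex 0) σ.toFun)
      (cont_top_iff.mpr (continuous_topCone _ (cont_top_iff.mp σ.cont)))
  face_zero n σ := CMap.ext (funext fun (x : stdSimplex ℝ (Fin (n + 1))) =>
    topCone_face_zero (stdSimplex.vertex 0) (σ.toFun : stdSimplex ℝ (Fin (n + 1)) →
      stdSimplex ℝ (Fin (m + 1))) x)
  face_one σ := CMap.ext (funext fun (x : stdSimplex ℝ (Fin 1)) =>
    topCone_face_one (stdSimplex.vertex 0) (σ.toFun : stdSimplex ℝ (Fin 1) →
      stdSimplex ℝ (Fin (m + 1))) x)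
  face_succ n i σ := CMap.ext (funext fun (x : stdSimplex ℝ (Fin (n + 2))) =>
    topCone_face_succ (stdSimplex.vertex 0) (σ.toFun : stdSimplex ℝ (Fin (n + 2)) →
      stdSimplex ℝ (Fin (m + 1))) i x)

/-- The cone over singular simplices of a simplex. -/
noncomputable def coningSimplex (J : Interval) (m : ℕ) : Coning J (J.simplex.obj ⦋m⦌) :=
  match J with
  | .I => coningI m
  | .JPlus => coningJPlus m
  | .JOne => coningJOne m

/-- The Eilenberg–Zilber theorem for simplicial chains. -/
theorem eilenbergZilber_simplicial (J : Interval) :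
    Nonempty (NaturalHomotopyEquiv (Cl.prodFunctor.{u} ⋙ simplicialChains J)
      ((simplicialChains J).prod (simplicialChains J) ⋙ tensorComplex)) :=
  eilenbergZilber (simplicialChains J) (fun n => Cl.ulift (J.simplex.obj ⦋n⦌))
    (simplicialChainsRetract J) (simplicialAug J) simplicialAug_natural
    (fun n => (coningSimplex J n).ulift.contractible)
    (fun i k => ((coningSimplex J i).ulift.prod (coningSimplex J k).ulift).contractible)

end Cones

/-! ### Cubical contractions -/

/-- A contraction of a space to a point parametrized by the interval `J`. -/
structure Contraction (J : Interval) (X : Cl.{u}) where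
  apex : X
  map : CMap (X × J.space) X
  map_zero : ∀ x, map.toFun (x, J.zero) = x
  map_one : ∀ x, map.toFun (x, J.one) = apex

namespace Contraction

variable {J : Interval} {X Y : Cl.{u}}

/-- Products contract componentwise. -/
def prod (c : Contraction J X) (d : Contraction J Y) :
    Contraction J (Cl.prodFunctor.obj (X, Y)) where
  apex := (c.apex, d.apex)
  map := CMap.pair
    (c.map.comp (CMap.pair ((CMap.fst X Y).comp (CMap.fst (X × Y) J.space))
      (CMap.snd (X × Y) J.space)))
    (d.map.comp (CMap.pair ((CMap.snd X Y).comp (CMap.fst (X × Y) J.space))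
      (CMap.snd (X × Y) J.space)))
  map_zero x := Prod.ext (c.map_zero x.1) (d.map_zero x.2)
  map_one x := Prod.ext (c.map_one x.1) (d.map_one x.2)

/-- The contraction of a lifted space. -/
def ulift {S : Cl.{0}} (c : Contraction J S) : Contraction J (Cl.ulift.{u} S) where
  apex := ULift.up c.apex
  map := (Cl.up S).comp (c.map.comp (CMap.pair ((Cl.down S).comp (CMap.fst _ J.space))
    (CMap.snd _ J.space)))
  map_zero x := congrArg ULift.up (c.map_zero x.down)
  map_one x := congrArg ULift.up (c.map_one x.down)

/-- Powers contract componentwise. -/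
def pow {S : Cl.{0}} (c : Contraction J S) (n : ℕ) : Contraction J ⟨Fin n → S⟩ where
  apex := fun _ => c.apex
  map := CMap.pi fun i => c.map.comp (CMap.pair
    ((CMap.eval (A := fun _ => S) i).comp (CMap.fst (Fin n → S) J.space))
    (CMap.snd (Fin n → S) J.space))
  map_zero x := funext fun i => c.map_zero (x i)
  map_one x := funext fun i => c.map_one (x i)

end Contraction

/-! ### Neighborhood filters and the contraction of the interval. -/

theorem cont_of_tendsto_prod {X : Type u} {Y : Type v} {Z : Type w} [ClosureSpace X]
    [ClosureSpace Y] [ClosureSpace Z] {f : X × Y → Z}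
    (h : ∀ x y, Filter.Tendsto f (nhd x ×ˢ nhd y) (nhd (f (x, y)))) : Cont f :=
  cont_iff.mpr fun p => by
    rw [nhd_prod]
    exact h p.1 p.2

theorem nhd_top {X : Type u} [TopologicalSpace X] (x : X) : @nhd X (topClosure X) x = nhds x := by
  ext V
  change x ∉ closure Vᶜ ↔ _
  rw [closure_compl, Set.notMem_compl_iff, mem_interior_iff_mem_nhds]

/-- Each point has a least neighborhood, so the continuity of the maximum on `J₊` comes down to
monotonicity. -/
theorem nhd_up {X : Type u} [Preorder X] (x : X) :
    @nhd X (upClosure X) x = Filter.principal (Set.Iic x) := by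
  ext V
  change ¬ (∃ i ∈ Vᶜ, i ≤ x) ↔ _
  rw [Filter.mem_principal]
  push Not
  exact ⟨fun h i hi => by_contra fun hV => h i hV hi, fun h i hV hi => hV (h hi)⟩

/-- The interval contracts to its endpoint `1` by the maximum. -/
noncomputable def contractionInterval (J : Interval) : Contraction J J.space :=
  match J with
  | .I =>
    { apex := (1 : unitInterval)
      map :=
        { toFun := fun p : unitInterval × unitInterval => (max p.1 p.2 : unitInterval)
          cont := cont_of_tendsto_prod (X := Interval.space .I) (Y := Interval.space .I)
            (Z := Interval.space .I) fun (x y : unitInterval) => by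
            change Filter.Tendsto (fun p : unitInterval × unitInterval => max p.1 p.2)
              (@nhd _ (topClosure unitInterval) x ×ˢ @nhd _ (topClosure unitInterval) y)
              (@nhd _ (topClosure unitInterval) (max x y))
            rw [nhd_top, nhd_top, nhd_top, ← nhds_prod_eq]
            exact continuous_max.tendsto (x, y) }
      map_zero := fun x : unitInterval => max_eq_left unitInterval.nonneg'
      map_one := fun x : unitInterval => max_eq_right unitInterval.le_one' }
  | .JPlus =>
    { apex := (1 : Fin 2)
      map :=
        { toFun := fun p : Fin 2 × Fin 2 => (max p.1 p.2 : Fin 2)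
          cont := cont_of_tendsto_prod (X := Interval.space .JPlus) (Y := Interval.space .JPlus)
            (Z := Interval.space .JPlus) fun (x y : Fin 2) => by
            change Filter.Tendsto (fun p : Fin 2 × Fin 2 => max p.1 p.2)
              (@nhd _ (upClosure (Fin 2)) x ×ˢ @nhd _ (upClosure (Fin 2)) y)
              (@nhd _ (upClosure (Fin 2)) (max x y))
            rw [nhd_up, nhd_up, nhd_up, Filter.prod_principal_principal,
              Filter.tendsto_principal_principal]
            exact fun q hq => Set.mem_Iic.mpr
              (max_le_max (Set.mem_Iic.mp hq.1) (Set.mem_Iic.mp hq.2)) }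
      map_zero := fun x : Fin 2 => max_eq_left (Fin.zero_le x)
      map_one := fun x : Fin 2 => max_eq_right (Fin.le_last x) }
  | .JOne =>
    { apex := (1 : Fin 2)
      map :=
        { toFun := fun p : Fin 2 × Fin 2 => (max p.1 p.2 : Fin 2)
          cont := cont_indiscrete _ }
      map_zero := fun x : Fin 2 => max_eq_left (Fin.zero_le x)
      map_one := fun x : Fin 2 => max_eq_right (Fin.le_last x) }

/-! ### Cubical chains -/

section Cubical

open SingCube

variable {J : Interval} {X Y : Cl.{u}} {n : ℕ}

/-- The projection forgetting the first coordinate. -/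
def cubeTail (J : Interval) (n : ℕ) : CMap (J.Cube (n + 1)) (J.Cube n) :=
  CMap.pi fun i => CMap.eval (A := fun _ => J.space) i.succ

/-- The cylinder over a cube given by a contraction, with a new first coordinate. -/
def Contraction.cylinder (c : Contraction J X) (σ : SingCube J X n) : SingCube J X (n + 1) :=
  c.map.comp (CMap.pair (σ.comp (cubeTail J n)) (CMap.eval (A := fun _ => J.space) 0))

theorem cubeTail_insertNth_zero (e : J.space) (x : J.Cube n) :
    (cubeTail J n).toFun ((0 : Fin (n + 1)).insertNth e x) = x :=
  funext fun i => by simp [cubeTail, CMap.pi, CMap.eval]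

theorem cubeTail_insertNth_succ (i : Fin (n + 1)) (e : J.space) (x : J.Cube (n + 1)) :
    (cubeTail J (n + 1)).toFun (i.succ.insertNth e x) =
      i.insertNth e ((cubeTail J n).toFun x) := by
  refine Fin.eq_insertNth_iff.mpr ⟨?_, funext fun j => ?_⟩
  · exact Fin.insertNth_apply_same (α := fun _ => J.space) i.succ e x
  · have h := Fin.insertNth_apply_succAbove (α := fun _ => J.space) i.succ e x j.succ
    rw [Fin.succ_succAbove_succ] at h
    exact h

theorem Contraction.face_zero_zero (c : Contraction J X) (σ : SingCube J X n) :
    face 0 J.zero (c.cylinder σ) = σ :=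
  CMap.ext (funext fun x => (c.map_zero _).trans
    (congrArg σ.toFun (cubeTail_insertNth_zero J.zero x)))

theorem Contraction.face_zero_one (c : Contraction J X) (σ : SingCube J X n) :
    face 0 J.one (c.cylinder σ) = CMap.const _ c.apex :=
  CMap.ext (funext fun _ => c.map_one _)

theorem Contraction.face_succ (c : Contraction J X) (i : Fin (n + 1)) (e : J.space)
    (σ : SingCube J X (n + 1)) : face i.succ e (c.cylinder σ) = c.cylinder (face i e σ) := by
  refine CMap.ext (funext fun x => ?_)
  have h : (i.succ.insertNth e x : J.Cube (n + 2)) 0 = x 0 := by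
    have := Fin.insertNth_apply_succAbove (α := fun _ => J.space) i.succ e x 0
    rwa [Fin.succ_succAbove_zero] at this
  change c.map.toFun (σ.toFun ((cubeTail J (n + 1)).toFun (i.succ.insertNth e x)),
    (i.succ.insertNth e x : J.Cube (n + 2)) 0) = _
  rw [cubeTail_insertNth_succ, h]
  rfl

/-- The coordinate on which the cube does not depend survives in the cylinder, shifted by one. Hence
the cylinder descends to normalized chains. -/
theorem Contraction.degenerate_cylinder (c : Contraction J X) {σ : SingCube J X n}
    (h : Degenerate σ) : Degenerate (c.cylinder σ) := by
  obtain ⟨i, hi⟩ := h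
  refine ⟨i.succ, fun x t => ?_⟩
  have h1 : (cubeTail J n).toFun (Function.update x i.succ t) =
      Function.update ((cubeTail J n).toFun x) i t :=
    funext fun j => by simp [cubeTail, CMap.pi, CMap.eval, Function.update_apply]
  change c.map.toFun (σ.toFun ((cubeTail J n).toFun (Function.update x i.succ t)),
    Function.update x i.succ t 0) = _
  rw [h1, hi, Function.update_of_ne (Fin.succ_ne_zero i).symm]
  rfl

theorem degenerate_const (n : ℕ) (x : X) : Degenerate (J := J) (CMap.const (J.Cube (n + 1)) x) :=
  ⟨0, fun _ _ => rfl⟩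

variable (J) in
/-- The boundary of normalized cubical chains. -/
theorem cubicalChains_d (X : Cl.{u}) (n : ℕ) : (((cubicalChains J).obj X).d (n + 1) n).hom =
    Submodule.mapQ _ _ (CubeChains.boundary J X n) (CubeChains.degenerate_le J X n) :=
  by
  change ((cubicalComplex J X).d (n + 1) n).hom = _
  simp only [cubicalComplex, ChainComplex.of_d]
  rfl

/-- The augmentation of normalized cubical chains in degree zero. -/
noncomputable def cubeCoeffSum (J : Interval) (X : Cl.{u}) :
    (CubeChains J X 0 ⧸ CubeChains.degenerate J X 0) →ₗ[ℤ] ℤ :=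
  Submodule.liftQ _ (coeffSum (SingCube J X 0)) (by
    refine Submodule.span_le.mpr ?_
    rintro _ ⟨σ, ⟨i, _⟩, rfl⟩
    -- A `0`-cube has no coordinates, so there are no degenerate ones.
    exact i.elim0)

theorem cubeCoeffSum_single (σ : SingCube J X 0) :
    cubeCoeffSum J X (Submodule.Quotient.mk (Finsupp.single σ 1)) = 1 :=
  coeffSum_single σ

/-- The augmentation of the normalized cubical chains. -/
noncomputable def cubicalAug (J : Interval) (X : Cl.{u}) :
    Augmentation ((cubicalChains J).obj X) where
  ε
    | 0 => cubeCoeffSum J X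
    | _ + 1 => 0
  ε_succ _ := rfl
  ε_d i j x := by
    by_cases hij : j + 1 = i
    · subst hij
      cases j with
      | succ j => rfl
      | zero =>
        have h : cubeCoeffSum J X ∘ₗ Submodule.mapQ _ _ (CubeChains.boundary J X 0)
            (CubeChains.degenerate_le J X 0) = 0 := by
          refine Submodule.linearMap_qext _ (Finsupp.lhom_ext' fun σ => LinearMap.ext_ring ?_)
          change coeffSum (SingCube J X 0) (CubeChains.boundary J X 0 (Finsupp.single σ 1)) = 0
          simp [CubeChains.boundary_single, coeffSum_single]
        rw [← cubicalChains_d] at h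
        exact LinearMap.congr_fun h x
    · rw [HomologicalComplex.shape _ i j hij]
      exact map_zero _

theorem cubicalAug_natural (f : X ⟶ Y) (x : ((cubicalChains J).obj X).X 0) :
    (cubicalAug J Y).ε 0 (((cubicalChains J).map f).f 0 x) = (cubicalAug J X).ε 0 x := by
  have h : cubeCoeffSum J Y ∘ₗ Submodule.mapQ _ _ (CubeChains.map J f 0)
      (CubeChains.degenerate_le_map J f 0) = cubeCoeffSum J X := by
    refine Submodule.linearMap_qext _ (Finsupp.lhom_ext' fun σ => LinearMap.ext_ring ?_)
    refine (congrArg (coeffSum _) (CubeChains.map_single J f 0 σ)).trans ?_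
    exact (coeffSum_single _).trans (coeffSum_single _).symm
  exact LinearMap.congr_fun h x

/-- The contracting homotopy on normalized cubical chains. -/
noncomputable def Contraction.homotopyMap (c : Contraction J X) (n : ℕ) :
    (CubeChains J X n ⧸ CubeChains.degenerate J X n) →ₗ[ℤ]
      (CubeChains J X (n + 1) ⧸ CubeChains.degenerate J X (n + 1)) :=
  -- The first coordinate enters the cubical boundary with sign `-1`, so the cylinder itself would
  -- contribute `-σ`; the minus sign corrects this.
  Submodule.mapQ _ _ (-Finsupp.lmapDomain ℤ ℤ c.cylinder) (by
    refine Submodule.span_le.mpr ?_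
    rintro _ ⟨σ, hσ, rfl⟩
    refine (CubeChains.degenerate J X (n + 1)).neg_mem ?_
    change Finsupp.mapDomain c.cylinder (Finsupp.single σ (1 : ℤ)) ∈ _
    rw [Finsupp.mapDomain_single]
    exact CubeChains.single_mem_degenerate J X (c.degenerate_cylinder hσ))

theorem Contraction.boundary_cylinder_zero (c : Contraction J X) (σ : SingCube J X 0) :
    CubeChains.boundary J X 0 (Finsupp.single (c.cylinder σ) (1 : ℤ)) =
      Finsupp.single (CMap.const _ c.apex) (1 : ℤ) - Finsupp.single σ (1 : ℤ) := by
  simp [CubeChains.boundary_single, c.face_zero_zero, c.face_zero_one]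

/-- The new first coordinate contributes the face at `1`, a constant cube, minus the face at `0`,
which is `σ`. Faces in the old coordinates are cylinders on faces, with index and hence sign
shifted. -/
theorem Contraction.boundary_cylinder (c : Contraction J X) (σ : SingCube J X (n + 1)) :
    CubeChains.boundary J X (n + 1) (Finsupp.single (c.cylinder σ) (1 : ℤ)) =
      Finsupp.single (CMap.const _ c.apex) (1 : ℤ) - Finsupp.single σ (1 : ℤ) -
        Finsupp.lmapDomain ℤ ℤ c.cylinder (CubeChains.boundary J X n (Finsupp.single σ (1 : ℤ))) := by
  rw [CubeChains.boundary_single, Fin.sum_univ_succ, CubeChains.boundary_single, map_sum]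
  simp only [c.face_zero_zero, c.face_zero_one, c.face_succ, Fin.val_succ, map_smul, map_sub,
    Finsupp.lmapDomain_apply, Finsupp.mapDomain_single, pow_succ _ (_ + 1), mul_neg_one, neg_smul,
    Finset.sum_neg_distrib]
  simp
  abel

theorem Contraction.contractible (c : Contraction J X) : (cubicalAug J X).Contractible := by
  refine Augmentation.contractible_of_maps _
    (fun n => (Submodule.Quotient.mk (Finsupp.single (CMap.const _ c.apex) (1 : ℤ)) :
      CubeChains J X n ⧸ CubeChains.degenerate J X n))
    (cubeCoeffSum_single _) c.homotopyMap ?_ ?_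
  · have h : LinearMap.id = Submodule.mapQ _ _ (CubeChains.boundary J X 0)
        (CubeChains.degenerate_le J X 0) ∘ₗ c.homotopyMap 0 +
        LinearMap.toSpanSingleton ℤ _ (Submodule.Quotient.mk
          (Finsupp.single (CMap.const _ c.apex) (1 : ℤ))) ∘ₗ cubeCoeffSum J X := by
      refine Submodule.linearMap_qext _ (Finsupp.lhom_ext' fun σ => LinearMap.ext_ring ?_)
      change (CubeChains.degenerate J X 0).mkQ (Finsupp.single σ (1 : ℤ)) =
        (CubeChains.degenerate J X 0).mkQ (CubeChains.boundary J X 0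
          (-Finsupp.mapDomain c.cylinder (Finsupp.single σ (1 : ℤ)))) +
        LinearMap.toSpanSingleton ℤ _ ((CubeChains.degenerate J X 0).mkQ
          (Finsupp.single (CMap.const _ c.apex) (1 : ℤ))) (coeffSum _ (Finsupp.single σ (1 : ℤ)))
      rw [Finsupp.mapDomain_single, map_neg, c.boundary_cylinder_zero, coeffSum_single,
        LinearMap.toSpanSingleton_apply, one_smul, ← map_add]
      congr 1
      abel
    rw [← cubicalChains_d] at h
    exact fun x => LinearMap.congr_fun h x
  · intro n
    have h : LinearMap.id = c.homotopyMap n ∘ₗ Submodule.mapQ _ _ (CubeChains.boundary J X n)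
        (CubeChains.degenerate_le J X n) + Submodule.mapQ _ _ (CubeChains.boundary J X (n + 1))
        (CubeChains.degenerate_le J X (n + 1)) ∘ₗ c.homotopyMap (n + 1) := by
      refine Submodule.linearMap_qext _ (Finsupp.lhom_ext' fun σ => LinearMap.ext_ring ?_)
      change (CubeChains.degenerate J X (n + 1)).mkQ (Finsupp.single σ (1 : ℤ)) =
        (CubeChains.degenerate J X (n + 1)).mkQ
        (-Finsupp.lmapDomain ℤ ℤ c.cylinder (CubeChains.boundary J X n (Finsupp.single σ (1 : ℤ)))) +
        (CubeChains.degenerate J X (n + 1)).mkQ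
        (CubeChains.boundary J X (n + 1) (-Finsupp.mapDomain c.cylinder (Finsupp.single σ (1 : ℤ))))
      rw [Finsupp.mapDomain_single, map_neg (CubeChains.boundary J X (n + 1)),
        c.boundary_cylinder, ← map_add]
      refine (Submodule.Quotient.eq _).mpr ?_
      -- After cancellation only the constant cube at the apex is left over, and in positive
      -- dimension it is degenerate.
      have hd := CubeChains.single_mem_degenerate J X (degenerate_const (J := J) n c.apex)
      convert hd using 1
      abel
    rw [← cubicalChains_d, ← cubicalChains_d] at h
    exact fun x => LinearMap.congr_fun h x

end Cubical

/-! ### Splitting off the degenerate cubes -/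

section Normalization

open SingCube

variable {J : Interval} {X Y : Cl.{u}} {n : ℕ}

/-- The endomorphism of a cube setting the coordinates in `S` to zero. -/
def zeroOn (J : Interval) (S : Finset (Fin n)) : CMap (J.Cube n) (J.Cube n) :=
  CMap.pi fun i => if i ∈ S then CMap.const _ J.zero else CMap.eval (A := fun _ => J.space) i

theorem zeroOn_apply (S : Finset (Fin n)) (x : J.Cube n) (i : Fin n) :
    (zeroOn J S).toFun x i = if i ∈ S then J.zero else x i := by
  by_cases h : i ∈ S <;> simp [zeroOn, CMap.pi, CMap.const, CMap.eval, h]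

theorem comp_zeroOn_empty (σ : SingCube J X n) : σ.comp (zeroOn J ∅) = σ := by
  refine CMap.ext (funext fun x => congrArg σ.toFun (funext fun i => ?_))
  exact (zeroOn_apply ∅ x i).trans (if_neg (Finset.notMem_empty i))

theorem degenerate_comp_zeroOn (σ : SingCube J X n) {S : Finset (Fin n)} (hS : S ≠ ∅) :
    Degenerate (σ.comp (zeroOn J S)) := by
  obtain ⟨i, hi⟩ := Finset.nonempty_iff_ne_empty.mpr hS
  refine ⟨i, fun x t => congrArg σ.toFun (funext fun j => ?_)⟩
  rw [zeroOn_apply, zeroOn_apply]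
  by_cases hj : j = i
  · subst hj
    rw [if_pos hi, if_pos hi]
  · rw [Function.update_of_ne hj]

theorem comp_zeroOn_insert {σ : SingCube J X n} {i : Fin n}
    (h : ∀ (x : J.Cube n) (t : J.space), σ.toFun (Function.update x i t) = σ.toFun x)
    (S : Finset (Fin n)) : σ.comp (zeroOn J (insert i S)) = σ.comp (zeroOn J S) := by
  refine CMap.ext (funext fun x => ?_)
  refine Eq.trans (congrArg σ.toFun (funext fun j => ?_)) (h ((zeroOn J S).toFun x) J.zero)
  rw [zeroOn_apply, Function.update_apply, zeroOn_apply]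
  by_cases hj : j = i <;> simp [hj]

/-- The alternating sum `∑ (-1)^|S| σ ∘ z_S` over the sets `S` of coordinates, where `z_S` sets the
coordinates in `S` to zero. -/
noncomputable def normalizeCubes (J : Interval) (X : Cl.{u}) (n : ℕ) :
    CubeChains J X n →ₗ[ℤ] CubeChains J X n :=
  ∑ S : Finset (Fin n), (-1 : ℤ) ^ S.card •
    Finsupp.lmapDomain ℤ ℤ (fun σ : SingCube J X n => σ.comp (zeroOn J S))

theorem normalizeCubes_single (σ : SingCube J X n) :
    normalizeCubes J X n (Finsupp.single σ 1) =
      ∑ S : Finset (Fin n), (-1 : ℤ) ^ S.card • Finsupp.single (σ.comp (zeroOn J S)) 1 := by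
  rw [normalizeCubes, LinearMap.sum_apply]
  refine Finset.sum_congr rfl fun S _ => ?_
  rw [LinearMap.smul_apply, Finsupp.lmapDomain_apply, Finsupp.mapDomain_single]

/-- If `σ` ignores the coordinate `i`, the terms for `S` and `insert i S` are the same cube with
opposite signs, so the sum cancels in pairs. -/
theorem normalizeCubes_degenerate {σ : SingCube J X n} (h : Degenerate σ) :
    normalizeCubes J X n (Finsupp.single σ 1) = 0 := by
  obtain ⟨i, hi⟩ := h
  rw [normalizeCubes_single, ← Finset.powerset_univ,
    ← Finset.insert_erase (Finset.mem_univ i),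
    Finset.sum_powerset_insert (Finset.notMem_erase i _), ← Finset.sum_add_distrib]
  refine Finset.sum_eq_zero fun S hS => ?_
  have hiS : i ∉ S := fun hiS => Finset.notMem_erase i _ (Finset.mem_powerset.mp hS hiS)
  rw [Finset.card_insert_of_notMem hiS, comp_zeroOn_insert hi, pow_succ, mul_neg_one, neg_smul,
    add_neg_cancel]

theorem degenerate_le_ker_normalizeCubes (J : Interval) (X : Cl.{u}) (n : ℕ) :
    CubeChains.degenerate J X n ≤ LinearMap.ker (normalizeCubes J X n) := by
  refine Submodule.span_le.mpr ?_
  rintro _ ⟨σ, hσ, rfl⟩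
  exact normalizeCubes_degenerate hσ

/-- A cube with some coordinate set to zero is degenerate, so modulo degenerate cubes only the term
`S = ∅` survives. -/
theorem mkQ_normalizeCubes (σ : SingCube J X n) :
    (CubeChains.degenerate J X n).mkQ (normalizeCubes J X n (Finsupp.single σ 1)) =
      (CubeChains.degenerate J X n).mkQ (Finsupp.single σ 1) := by
  rw [normalizeCubes_single, map_sum, Finset.sum_eq_single ∅]
  · rw [Finset.card_empty, pow_zero, one_smul, comp_zeroOn_empty]
  · intro S _ hS
    have h : (CubeChains.degenerate J X n).mkQ (Finsupp.single (σ.comp (zeroOn J S)) 1) = 0 :=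
      (Submodule.Quotient.mk_eq_zero _).mpr
        (CubeChains.single_mem_degenerate J X (degenerate_comp_zeroOn σ hS))
    rw [map_smul, h, smul_zero]
  · exact fun h => absurd (Finset.mem_univ _) h

/-- Setting coordinates to zero is precomposition, which commutes with postcomposition by `f`. This
makes the splitting natural in the space; no compatibility with the boundary is required of it. -/
theorem normalizeCubes_map (f : X ⟶ Y) (n : ℕ) :
    normalizeCubes J Y n ∘ₗ CubeChains.map J f n =
      CubeChains.map J f n ∘ₗ normalizeCubes J X n := by
  refine Finsupp.lhom_ext' fun σ => LinearMap.ext_ring ?_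
  change normalizeCubes J Y n (CubeChains.map J f n (Finsupp.single σ 1)) =
    CubeChains.map J f n (normalizeCubes J X n (Finsupp.single σ 1))
  rw [CubeChains.map_single, normalizeCubes_single, normalizeCubes_single, map_sum]
  refine Finset.sum_congr rfl fun S _ => ?_
  rw [map_smul, CubeChains.map_single]
  rfl

/-- Normalized cubical chains are a natural retract of the free functor on a lifted cube. -/
noncomputable def cubicalChainsRetract (J : Interval) (n : ℕ) :
    Retract ((degreewise (cubicalChains.{u} J)).X n) (freeOn (Cl.ulift ⟨J.Cube n⟩)) :=
  Retract.trans (Y := Cl.mapsFrom ⟨J.Cube n⟩ ⋙ freeMod ℤ)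
    { i :=
        { app := fun X => ModuleCat.ofHom (Submodule.liftQ _ (normalizeCubes J X n)
            (degenerate_le_ker_normalizeCubes J X n))
          naturality := fun X Y f => by
            refine ModuleCat.hom_ext (Submodule.linearMap_qext _ (LinearMap.ext fun c => ?_))
            exact LinearMap.congr_fun (normalizeCubes_map f n) c }
      r :=
        { app := fun X => ModuleCat.ofHom (CubeChains.degenerate J X n).mkQ
          naturality := fun X Y f => rfl }
      retract := by
        ext X : 2
        refine ModuleCat.hom_ext (Submodule.linearMap_qext _
          (Finsupp.lhom_ext' fun σ => LinearMap.ext_ring ?_))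
        exact mkQ_normalizeCubes σ }
    (Retract.ofIso (Functor.isoWhiskerRight (Cl.mapsFromIso _) (freeMod ℤ)))

/-- The Eilenberg–Zilber theorem for normalized cubical chains. -/
theorem eilenbergZilber_cubical (J : Interval) :
    Nonempty (NaturalHomotopyEquiv (Cl.prodFunctor.{u} ⋙ cubicalChains J)
      ((cubicalChains J).prod (cubicalChains J) ⋙ tensorComplex)) :=
  eilenbergZilber (cubicalChains J) (fun n => Cl.ulift ⟨J.Cube n⟩)
    (cubicalChainsRetract J) (cubicalAug J) cubicalAug_natural
    (fun n => ((contractionInterval J).pow n).ulift.contractible)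
    (fun i k => (((contractionInterval J).pow i).ulift.prod
      ((contractionInterval J).pow k).ulift).contractible)

end Normalization

end CechClosure

theorem theorem1p3 (J : CechClosure.Interval) :
    Nonempty (CechClosure.NaturalHomotopyEquiv
      (CechClosure.Cl.prodFunctor.{u} ⋙ CechClosure.simplicialChains J)
      ((CechClosure.simplicialChains J).prod (CechClosure.simplicialChains J) ⋙
        CechClosure.tensorComplex)) ∧
    Nonempty (CechClosure.NaturalHomotopyEquiv
      (CechClosure.Cl.prodFunctor.{u} ⋙ CechClosure.cubicalChains J)
      ((CechClosure.cubicalChains J).prod (CechClosure.cubicalChains J) ⋙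
        CechClosure.tensorComplex)) :=
  ⟨CechClosure.eilenbergZilber_simplicial J, CechClosure.eilenbergZilber_cubical J⟩
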